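/- **Hyperlogarithm spaces.** For a field $E$ and $n\ge 1$ let $E_\times^{n+2}$ be the set of $(n+2)$-tuples $(a_0,\dots,a_{n+1})$ of elements of $E$ with $a_0\neq a_1$ and $a_n\neq a_{n+1}$, and let $\mathbb{Q}[E_\times^{n+2}]$ be the $\mathbb{Q}$-vector space with basis the symbols $[a_0|a_1,\dots,a_n|a_{n+1}]$, $(a_0,\dots,a_{n+1})\in E_\times^{n+2}$. Define by induction on $n$, simultaneously for all fields $E$, subspaces $\mathcal{R}_n(E)\subset\mathbb{Q}[E_\times^{n+2}]$ and quotients $\mathcal{H}_n(E)=\mathbb{Q}[E_\times^{n+2}]/\mathcal{R}_n(E)$ as follows. * $\mathcal{R}_1(E)$ is the kernel of $\mathbb{Q}[E_\times^{3}]\to E^\times\otimes\mathbb{Q}$, $[a|x|b]\mapsto \frac{b-x}{a-x}$, so that $\mathcal{H}_1(E)=E^\times\otimes\mathbb{Q}$. * For $n\ge2$ let $$\delta_n:\mathbb{Q}[E_\times^{n+2}]\to\bigoplus_{0<k<n/2}\mathcal{H}_{n-k}(E)\otimes\mathcal{H}_k(E)\ \oplus\ \Lambda^2\mathcal{H}_{n/2}(E)$$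 (the last term is absent for odd $n$) be the cobracket $$\delta_n[a_0|a_1,\dots,a_n|a_{n+1}]=\sum_{\substack{i\ge 0,\ 0<l<n\\ i+l\le n}}[a_0|a_1,\dots,a_i,a_{i+l+1},\dots,a_n|a_{n+1}]\wedge[a_i|a_{i+1},\dots,a_{i+l}|a_{i+l+1}],$$ where $x\wedge y$, for $x,y$ of weights $p,q$, stands for $x\otimes y$ if $p>q$, for $-y\otimes x$ if $p<q$, and for the class of $x\otimes y$ in $\Lambda^2$ if $p=q$. Divergent symbols on the right are replaced by their shuffle regularizations modulo products: in weight $1$, $[a|x|b]$ is $\frac{b-x}{a-x}$ with vanishing differences replaced by $1$; in weight $\ge2$, a word $a^k c\,v$ with $c\ne a$ following the initial point $a$ is replaced by $(-1)^k\,c\,(a^k ⧢ v)$ (with $⧢$ the shuffle product; a power of $a$ is replaced by $0$), and symmetrically at the final point. * For $n\ge 2$, $\mathcal{R}_n(E)$ is spanned by the symbols with $a_0=a_{n+1}$ (constant path) and by the elements $\alpha(1)-\alpha(0)$, where $\alpha$ runs through the elements of $\ker\delta_n\subset\mathbb{Q}[E(t)_\times^{n+2}]$ ($t$ a variable) that can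 be evaluated at $t=0$ and $t=1$, i.e. all the tuples occurring in $\alpha$ have entries without pole at $0$ and $1$ and their values at $0$ and at $1$ lie in $E_\times^{n+2}$. The class of a symbol in $\mathcal{H}_n(E)$ is denoted by the same symbol. **Notation.** For $x\ne0$, $y\ne1$ in $E$ put $[x,y]_{3,1}=[0|x,0,0,y|1]\in\mathcal{H}_4(E)$. For $x\in E\setminus\{0,1\}$ let $[x]_4=-[0|1,0,0,0|x]\in\mathcal{H}_4(E)$ be the $4$-logarithm (recall $\mathrm{Li}_4(x)=\int_0^x\frac{dt}{1-t}\circ\frac{dt}{t}\circ\frac{dt}{t}\circ\frac{dt}{t}$). For four distinct points of $\mathbb{P}^1(E)=E\cup\{\infty\}$ write $ABCD=\frac{(A-C)(B-D)}{(A-D)(B-C)}$ for their cross-ratio. For a function $h$ of five variables put $\mathrm{cycl}\,h(A_1,\dots,A_5)=\sum_{i=1}^5h(A_i,\dots,A_5,A_1,\dots,A_{i-1})$. **Theorem.** Let $E$ be a field, and let $A,B,C,D,E_0,F\in E$ be such that $A,B,C,D,E_0$ are distinct and $B,C,D,E_0,F$ are distinct. Then, in $\mathcal{H}_4(E)$,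 $$[A|B,C,D,E_0|F]=f(A,B,C,D,E_0)-f(B,C,D,E_0,F),$$ where $$\begin{aligned}20f(A,B,C,D,E_0)={}&g(A,B,C,D,E_0)-g(\infty,B,C,D,E_0)-g(A,\infty,C,D,E_0)\\&-g(A,B,\infty,D,E_0)-g(A,B,C,\infty,E_0)-g(A,B,C,D,\infty)\\&+10\,\mathrm{cycl}\Big[\tfrac{B-C}{B-A}\Big]_4-10\,\mathrm{cycl}\Big[\tfrac{A-B}{A-D}\Big]_4+10\,\mathrm{cycl}\Big[\tfrac{B-A}{B-D}\Big]_4-10\,\mathrm{cycl}\Big[\tfrac{D-B}{D-A}\Big]_4\end{aligned}$$ and $$g(A,B,C,D,E_0)=\mathrm{cycl}\big\{[ABCD,ABCE_0]_{3,1}-[E_0DCB,E_0DCA]_{3,1}-3[ABDC,ABDE_0]_{3,1}+3[E_0DBC,E_0DBA]_{3,1}\big\}.$$ Here $\mathrm{cycl}$ is taken with respect to the five variables $(A,B,C,D,E_0)$ in this order. -/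

import Mathlib

open scoped TensorProduct

universe u

namespace Hyperlog

section Words

variable {E : Type u}

/-- The convergence condition on `[a | w | b]`, where `w = (a₁, …, aₙ)`:
`a ≠ a₁` and `aₙ ≠ b`. -/
def IsConvergent (n : ℕ) (a : E) (w : List E) (b : E) : Prop :=
  w.length = n ∧ w.head? ≠ some a ∧ w.getLast? ≠ some b

/-- The set of `(n+2)`-tuples `(a₀, a₁, …, aₙ, aₙ₊₁)` in `E` with `a₀ ≠ a₁` and `aₙ ≠ aₙ₊₁`,
written as `left = a₀`, `word = [a₁, …, aₙ]`, `right = aₙ₊₁`. -/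
@[ext]
structure Symb (E : Type u) (n : ℕ) where
  left : E
  word : List E
  right : E
  convergent : IsConvergent n left word right

open Classical in
/-- The basis vector `[a | w | b]` of `ℚ[E_×^{n+2}]` (and `0` if `(a, w, b)` is not convergent
or not of weight `n`). -/
noncomputable def symb (n : ℕ) (a : E) (w : List E) (b : E) : Symb E n →₀ ℚ :=
  if h : IsConvergent n a w b then Finsupp.single ⟨a, w, b, h⟩ 1 else 0

/-- The list, with multiplicities, of all shuffles of two words. -/
def shuffle : List E → List E → List (List E)
  | [], v => [v]
  | u, [] => [u]
  | x :: u, y :: v =>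
      (shuffle u (y :: v)).map (x :: ·) ++ (shuffle (x :: u) v).map (y :: ·)
termination_by u v => u.length + v.length

open Classical in
/-- Shuffle regularization, modulo products, at the lower end point `a`: a word
`a ⋯ a c v` with `k` letters `a` in front of `c ≠ a` is replaced by
`(-1)^k c (a^k ⧢ v)`, and a power of `a` by `0`. -/
noncomputable def regLeft (a : E) (w : List E) : List E →₀ ℚ :=
  match w.dropWhile (fun x => decide (x = a)) with
  | [] => 0
  | c :: v =>
      let k := (w.takeWhile (fun x => decide (x = a))).length
      (-1 : ℚ) ^ k •
        ((shuffle (List.replicate k a) v).map fun s => Finsupp.single (c :: s) (1 : ℚ)).sum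

/-- Shuffle regularization, modulo products, at the upper end point `b`. -/
noncomputable def regRight (b : E) (w : List E) : List E →₀ ℚ :=
  (regLeft b w.reverse).mapDomain List.reverse

/-- Shuffle regularization, modulo products, of a symbol of weight `n ≥ 2`
that is possibly divergent. On a convergent symbol it is the symbol itself. -/
noncomputable def regShuffle (n : ℕ) (a : E) (w : List E) (b : E) : Symb E n →₀ ℚ :=
  (regLeft a w).sum fun u p => (regRight b u).sum fun v q => (p * q) • symb n a v b

variable [Field E]

open Classical in
/-- `x` itself if `x ≠ 0`, and `1` if `x = 0`: the leading coefficient that enters regularized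
logarithms. -/
noncomputable def nz (x : E) : E := if x = 0 then 1 else x

/-- The regularized value of a symbol of weight `n`, as a combination of convergent symbols.
In weight `1`, where `[a | x | b]` stands for the logarithm of `(b - x) / (a - x)`, vanishing
differences are replaced by `1`, and the logarithm of `r` is written as `[1 | 0 | r]`.
In weight `n ≥ 2` it is the shuffle regularization modulo products. -/
noncomputable def reg (n : ℕ) (a : E) (w : List E) (b : E) : Symb E n →₀ ℚ :=
  match n, w with
  | 1, [x] => symb 1 1 [0] (nz (b - x) / nz (a - x))
  | 1, _ => 0
  | n, w => regShuffle n a w b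

end Words

section Cobracket

variable {E : Type u} [Field E]

/-- The class of the regularized symbol `[a | w | b]` modulo a space `R` of relations. -/
noncomputable def cls {n : ℕ} (R : Submodule ℚ (Symb E n →₀ ℚ)) (a : E) (w : List E) (b : E) :
    (Symb E n →₀ ℚ) ⧸ R :=
  R.mkQ (reg n a w b)

/-- The part in weights `(k, l)` of the coproduct of iterated integrals, modulo products, of
`[a₀ | a₁, …, aₖ₊ₗ | aₖ₊ₗ₊₁]`: the sum over `0 ≤ i ≤ k` of
`[a₀ | a₁, …, aᵢ, aᵢ₊ₗ₊₁, …, aₖ₊ₗ | aₖ₊ₗ₊₁] ⊗ [aᵢ | aᵢ₊₁, …, aᵢ₊ₗ | aᵢ₊ₗ₊₁]`. -/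
noncomputable def coprod {k l : ℕ} (Rk : Submodule ℚ (Symb E k →₀ ℚ))
    (Rl : Submodule ℚ (Symb E l →₀ ℚ)) (a : E) (w : List E) (b : E) :
    ((Symb E k →₀ ℚ) ⧸ Rk) ⊗[ℚ] ((Symb E l →₀ ℚ) ⧸ Rl) :=
  ∑ i ∈ Finset.range (k + 1),
    cls Rk a (w.take i ++ w.drop (i + l)) b ⊗ₜ[ℚ]
      cls Rl ((a :: w).getD i 0) ((w.drop i).take l) ((w ++ [b]).getD (i + l) 0)

/-- The linear extension of `coprod` to `ℚ[E_×^{n+2}]`, to be used for `n = k + l`. -/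
noncomputable def coprodLin {k l : ℕ} (n : ℕ) (Rk : Submodule ℚ (Symb E k →₀ ℚ))
    (Rl : Submodule ℚ (Symb E l →₀ ℚ)) :
    (Symb E n →₀ ℚ) →ₗ[ℚ] ((Symb E k →₀ ℚ) ⧸ Rk) ⊗[ℚ] ((Symb E l →₀ ℚ) ⧸ Rl) :=
  Finsupp.linearCombination ℚ fun s : Symb E n => coprod Rk Rl s.left s.word s.right

/-- The component in `H_k ⊗ H_l` (with `k > l`, `n = k + l`) of the cobracket `δ_n`, that is, of
the antisymmetrized coproduct. -/
noncomputable def delta {k l : ℕ} (n : ℕ) (Rk : Submodule ℚ (Symb E k →₀ ℚ))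
    (Rl : Submodule ℚ (Symb E l →₀ ℚ)) :
    (Symb E n →₀ ℚ) →ₗ[ℚ] ((Symb E k →₀ ℚ) ⧸ Rk) ⊗[ℚ] ((Symb E l →₀ ℚ) ⧸ Rl) :=
  coprodLin n Rk Rl - (TensorProduct.comm ℚ _ _).toLinearMap ∘ₗ coprodLin n Rl Rk

/-- The component in `Λ² H_k` (with `n = 2 k`) of the cobracket `δ_n`; the second exterior power
is viewed inside the exterior algebra. -/
noncomputable def deltaWedge {k : ℕ} (n : ℕ) (Rk : Submodule ℚ (Symb E k →₀ ℚ)) :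
    (Symb E n →₀ ℚ) →ₗ[ℚ] ExteriorAlgebra ℚ ((Symb E k →₀ ℚ) ⧸ Rk) :=
  LinearMap.mul' ℚ _ ∘ₗ
    TensorProduct.map (ExteriorAlgebra.ι ℚ) (ExteriorAlgebra.ι ℚ) ∘ₗ coprodLin n Rk Rk

end Cobracket

section Relations

variable {E : Type u} [Field E]

/-- The value at `t = c` of a rational function in `t`. -/
noncomputable def value (c : E) (p : RatFunc E) : E := p.eval (RingHom.id E) c

/-- The rational function `p` has no pole at `c`. -/
def RegularAt (c : E) (p : RatFunc E) : Prop := p.denom.eval c ≠ 0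

/-- A tuple over `E(t)` can be evaluated at `t = c`: its entries have no pole at `c`, and its
value satisfies the convergence condition again. -/
def Symb.Specializes {n : ℕ} (c : E) (s : Symb (RatFunc E) n) : Prop :=
  RegularAt c s.left ∧ (∀ p ∈ s.word, RegularAt c p) ∧ RegularAt c s.right ∧
    IsConvergent n (value c s.left) (s.word.map (value c)) (value c s.right)

/-- The value `α(c)` of a combination `α` of tuples over `E(t)`. -/
noncomputable def specialize (n : ℕ) (c : E) : (Symb (RatFunc E) n →₀ ℚ) →ₗ[ℚ] (Symb E n →₀ ℚ) :=
  Finsupp.linearCombination ℚ fun s : Symb (RatFunc E) n =>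
    symb n (value c s.left) (s.word.map (value c)) (value c s.right)

open Classical in
/-- The class of `r` in `E^×_ℚ = ℚ ⊗ E^×` (and `0` if `r = 0`). -/
noncomputable def unitClass (r : E) : ℚ ⊗[ℤ] Additive Eˣ :=
  if h : r = 0 then 0 else (1 : ℚ) ⊗ₜ[ℤ] Additive.ofMul (Units.mk0 r h)

/-- The map `ℚ[E_×^3] → E^×_ℚ`, `[a | x | b] ↦ (b - x) / (a - x)`. -/
noncomputable def logMap (E : Type u) [Field E] :
    (Symb E 1 →₀ ℚ) →ₗ[ℚ] ℚ ⊗[ℤ] Additive Eˣ :=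
  Finsupp.linearCombination ℚ fun s : Symb E 1 =>
    unitClass ((s.right - s.word.headD 0) / (s.left - s.word.headD 0))

end Relations

/-- The space of relations between hyperlogarithms of weight `n` over the field `E`.
In weight `1` they are such that the quotient is `E^×_ℚ`. In weight `n ≥ 2` they are spanned by the
symbols `[a | w | a]` (integrals over a constant path) and by the differences
`α(1) - α(0)`, for all `α` over `E(t)` that can be evaluated at `0` and at `1` and that are
killed by the cobracket
`δ_n : ℚ[E(t)_×^{n+2}] → ⨁_{0 < k < n/2} H_{n-k}(E(t)) ⊗ H_k(E(t)) ⊕ Λ² H_{n/2}(E(t))`. -/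
noncomputable def relations : (n : ℕ) → (E : Type u) → [Field E] → Submodule ℚ (Symb E n →₀ ℚ)
  | 0, _, _ => ⊤
  | 1, E, _ => LinearMap.ker (logMap E)
  | n + 2, E, _ =>
      Submodule.span ℚ
        ({ξ | ∃ s : Symb E (n + 2), s.left = s.right ∧ ξ = Finsupp.single s 1} ∪
         {ξ | ∃ α : Symb (RatFunc E) (n + 2) →₀ ℚ,
            (∀ k : ℕ, ∀ _ : 0 < k ∧ 2 * k < n + 2,
              delta (n + 2) (relations (n + 2 - k) (RatFunc E)) (relations k (RatFunc E)) α = 0) ∧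
            (∀ k : ℕ, ∀ _ : 2 * k = n + 2,
              deltaWedge (n + 2) (relations k (RatFunc E)) α = 0) ∧
            (∀ s ∈ α.support, s.Specializes (0 : E) ∧ s.Specializes (1 : E)) ∧
            ξ = specialize (n + 2) (1 : E) α - specialize (n + 2) (0 : E) α})
termination_by n => n
decreasing_by all_goals omega

/-- The space `H_n(E)` of hyperlogarithms of weight `n` over the field `E`. -/
abbrev H (n : ℕ) (E : Type u) [Field E] : Type u := (Symb E n →₀ ℚ) ⧸ relations n E

section Formula

variable {K : Type u} [Field K]

/-- The hyperlogarithm `[a | w | b]` in `H_n(K)`, where `w` has length `n`. -/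
noncomputable def hyp (n : ℕ) (a : K) (w : List K) (b : K) : H n K :=
  (relations n K).mkQ (symb n a w b)

/-- `[x, y]_{3,1} = [0 | x, 0, 0, y | 1]`, for `x ≠ 0` and `y ≠ 1`. -/
noncomputable def hyp31 (x y : K) : H 4 K := hyp 4 0 [x, 0, 0, y] 1

/-- The `4`-logarithm `[x]_4` in `H_4(K)`. As `Li_4(x)` is the iterated integral of
`dt/(1-t), dt/t, dt/t, dt/t` from `0` to `x`, this is `-[0 | 1, 0, 0, 0 | x]`. -/
noncomputable def polylog4 (x : K) : H 4 K := -hyp 4 0 [1, 0, 0, 0] x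

/-- The difference `p - q` of two points of the projective line, replaced by `1` if one of them
is `∞`. -/
def diff : OnePoint K → OnePoint K → K
  | OnePoint.some p, OnePoint.some q => p - q
  | _, _ => 1

/-- The cross-ratio `ABCD = (A-C)(B-D) / ((A-D)(B-C))` of four distinct points of the projective
line; if one of them is `∞`, the two factors containing it cancel. -/
def crossRatio (A B C D : OnePoint K) : K :=
  (diff A C * diff B D) / (diff A D * diff B C)

/-- The sum of `h` over the five cyclic permutations of its arguments. -/
def cycl {X M : Type*} [Add M] (h : X → X → X → X → X → M) (A B C D E : X) : M :=
  h A B C D E + h B C D E A + h C D E A B + h D E A B C + h E A B C D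

/-- The part of the formula that is built from two-variable hyperlogarithms. -/
noncomputable def g : OnePoint K → OnePoint K → OnePoint K → OnePoint K → OnePoint K → H 4 K :=
  cycl fun A B C D E =>
    hyp31 (crossRatio A B C D) (crossRatio A B C E)
      - hyp31 (crossRatio E D C B) (crossRatio E D C A)
      - (3 : ℚ) • hyp31 (crossRatio A B D C) (crossRatio A B D E)
      + (3 : ℚ) • hyp31 (crossRatio E D B C) (crossRatio E D B A)

/-- The function `f` of five distinct points of `K`. -/
noncomputable def f (A B C D E : K) : H 4 K :=
  (1 / 20 : ℚ) •
    (g (A : OnePoint K) B C D E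
      - g OnePoint.infty B C D E
      - g A OnePoint.infty C D E
      - g A B OnePoint.infty D E
      - g A B C OnePoint.infty E
      - g A B C D OnePoint.infty
      + (10 : ℚ) • cycl (fun A B C _ _ => polylog4 ((B - C) / (B - A))) A B C D E
      - (10 : ℚ) • cycl (fun A B _ D _ => polylog4 ((A - B) / (A - D))) A B C D E
      + (10 : ℚ) • cycl (fun A B _ D _ => polylog4 ((B - A) / (B - D))) A B C D E
      - (10 : ℚ) • cycl (fun A B _ D _ => polylog4 ((D - B) / (D - A))) A B C D E)

end Formula

end Hyperlog

/-!
The idea is to deform a combination of hyperlogarithms along a path of configurations of points.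
By the definition of the relations, a combination of symbols in points that depend on `t` has the
same class at `t = 0` and `t = 1` as soon as its cobracket vanishes at the generic point
(`lsum_hypAt_eq_of_delta`). For the formula, the point `F` is moved to `A`. At the end of the path
the left-hand side is an integral over a constant path, hence zero, and the right-hand side
`f(A, B, C, D, E) - f(B, C, D, E, A)` is zero because `f` is invariant under cyclic permutations
(`f_rotate`). So everything rests on the vanishing of the cobracket of the difference of both sides
for generic points, which has a component in `H_3 ⊗ H_1` (`delta_formula`) and one in `Λ² H_2`
(`deltaWedge_formula`).

These components are compared by the same principle in lower weight.

* In weight one, `H_1` is generated by logarithms `lg` of differences of points. The logarithm of a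
  difference of cross-ratios is a combination of such logarithms (`lsum_logL`).
* In weight two, every symbol is a difference of two values of the function `dilog` of three
  points (`cls_two`), which is alternating and affinely invariant and satisfies the five-term
  relation `dilog_inv`. Hence every symbol in cross-ratios is a combination of the elements
  `dilog (p i) (p j) (p k)` with `i < j < k` (`lsum_dilogL`).
* In weight three, the cobracket of a symbol is by the above an explicit element of the free
  module on pairs of a triple and a pair of points. A combination of symbols for which this
  element vanishes (`Closed3`) does not depend on the points; it is zero if moreover some
  substitution of the points changes its sign (`Closed3.lsum_eq_zero`), or if it
  becomes a sum of integrals over constant paths when two points collide.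

In weight four, the component in `H_3 ⊗ H_1` of the cobracket of `20 f(A, B, C, D, E)` is
`20 ∑ [A | B, C, D | E] ⊗ lg (E - A)`, and the one in `Λ² H_2` is
`20 ∑ dilog(A, B, C) ∧ dilog(C, D, E)`, both sums being cyclic. For the first, the coefficient in
`H_3` of the logarithm of each edge and each diagonal of the pentagon is antisymmetric under the
reflection of the pentagon that exchanges the two ends (`defect_eval`); for the second, it
suffices that the matrix of coefficients of the difference is symmetric
(`wedgeDefect_symmetric`). Subtracting the same expression for `B, C, D, E, F` leaves the cobracket
of `[A | B, C, D, E | F]` (`genericDefect_eval`, `generic_wedge_symmetric`).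

All these identities are between integral combinations of finitely many symbols in the points with
indices `0, …, 5` and `∞`, which has the index `6`; they are decided by computation.
-/

namespace Hyperlog

/-! ### Integral combinations -/

section Lsum

variable {α β M N : Type*} [AddCommGroup M] [AddCommGroup N]

/-- The combination `∑ cᵢ v(sᵢ)` encoded by the list of pairs `(cᵢ, sᵢ)`. -/
def lsum (L : List (ℤ × α)) (v : α → M) : M := (L.map fun t => t.1 • v t.2).sum

@[simp] theorem lsum_nil (v : α → M) : lsum [] v = 0 := rfl

@[simp] theorem lsum_cons (t : ℤ × α) (L : List (ℤ × α)) (v : α → M) :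
    lsum (t :: L) v = t.1 • v t.2 + lsum L v := by simp [lsum]

@[simp] theorem lsum_append (L L' : List (ℤ × α)) (v : α → M) :
    lsum (L ++ L') v = lsum L v + lsum L' v := by simp [lsum]

theorem lsum_congr {L : List (ℤ × α)} {v w : α → M} (h : ∀ t ∈ L, v t.2 = w t.2) :
    lsum L v = lsum L w := by
  induction L with
  | nil => rfl
  | cons t L ih =>
    rw [lsum_cons, lsum_cons, h t (by simp), ih fun s hs => h s (by simp [hs])]

theorem map_lsum {F : Type*} [FunLike F M N] [AddMonoidHomClass F M N] (φ : F)
    (L : List (ℤ × α)) (v : α → M) : φ (lsum L v) = lsum L fun s => φ (v s) := by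
  induction L with
  | nil => simp
  | cons t L ih => simp [ih, map_zsmul]

theorem lsum_neg (L : List (ℤ × α)) (v : α → M) : lsum L (fun s => -v s) = -lsum L v := by
  induction L with
  | nil => simp
  | cons t L ih => rw [lsum_cons, lsum_cons, ih, smul_neg, neg_add]

/-- The combination in which every coefficient is multiplied by `c`. -/
def scale (c : ℤ) (L : List (ℤ × α)) : List (ℤ × α) := L.map fun t => (c * t.1, t.2)

@[simp] theorem lsum_scale (c : ℤ) (L : List (ℤ × α)) (v : α → M) :
    lsum (scale c L) v = c • lsum L v := by
  induction L with
  | nil => simp [scale]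
  | cons t L ih =>
    have : scale c (t :: L) = (c * t.1, t.2) :: scale c L := rfl
    rw [this, lsum_cons, lsum_cons, ih, smul_add, mul_smul]

/-- Substitution of combinations for the symbols of a combination. -/
def lbind (L : List (ℤ × α)) (φ : α → List (ℤ × β)) : List (ℤ × β) :=
  L.flatMap fun t => scale t.1 (φ t.2)

@[simp] theorem lbind_nil (φ : α → List (ℤ × β)) : lbind [] φ = [] := rfl

theorem lbind_cons (t : ℤ × α) (L : List (ℤ × α)) (φ : α → List (ℤ × β)) :
    lbind (t :: L) φ = scale t.1 (φ t.2) ++ lbind L φ := rfl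

@[simp] theorem lsum_lbind (L : List (ℤ × α)) (φ : α → List (ℤ × β)) (v : β → M) :
    lsum (lbind L φ) v = lsum L fun s => lsum (φ s) v := by
  induction L with
  | nil => simp
  | cons t L ih => simp [lbind_cons, ih]

/-- Addition of one term to a combination, with collection of equal symbols. -/
def collectInsert [DecidableEq α] (c : ℤ) (s : α) : List (ℤ × α) → List (ℤ × α)
  | [] => [(c, s)]
  | t :: L => if t.2 = s then (if t.1 + c = 0 then L else (t.1 + c, s) :: L)
      else t :: collectInsert c s L

/-- Collection of equal symbols in a combination. -/
def collect [DecidableEq α] : List (ℤ × α) → List (ℤ × α)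
  | [] => []
  | t :: L => collectInsert t.1 t.2 (collect L)

theorem lsum_collectInsert [DecidableEq α] (c : ℤ) (s : α) (L : List (ℤ × α)) (v : α → M) :
    lsum (collectInsert c s L) v = c • v s + lsum L v := by
  induction L with
  | nil => simp [collectInsert]
  | cons t L ih =>
    unfold collectInsert
    split_ifs with h h'
    · have : c • v s = -(t.1 • v t.2) := by
        rw [h, eq_neg_iff_add_eq_zero, ← add_smul, add_comm c, h', zero_smul]
      rw [lsum_cons, this]; abel
    · rw [lsum_cons, lsum_cons, add_smul, h]; abel
    · rw [lsum_cons, lsum_cons, ih]; abel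

theorem lsum_collect [DecidableEq α] (L : List (ℤ × α)) (v : α → M) :
    lsum (collect L) v = lsum L v := by
  induction L with
  | nil => rfl
  | cons t L ih => rw [collect, lsum_collectInsert, ih, lsum_cons]

/-- A combination that vanishes after collection of equal symbols. -/
def Cancels [DecidableEq α] (L : List (ℤ × α)) : Prop := collect L = []

instance [DecidableEq α] (L : List (ℤ × α)) : Decidable (Cancels L) :=
  inferInstanceAs (Decidable (collect L = []))

theorem Cancels.lsum_eq_zero [DecidableEq α] {L : List (ℤ × α)} (h : Cancels L) (v : α → M) :
    lsum L v = 0 := by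
  rw [← lsum_collect, h, lsum_nil]

end Lsum

/-! ### Evaluation of rational functions -/

section Spec

variable {E : Type u} [Field E]

/-- The rational function `p` is regular at `c` and takes the value `v` there. -/
def Spec (c : E) (p : RatFunc E) (v : E) : Prop := RegularAt c p ∧ value c p = v

variable {c v w : E} {p q : RatFunc E}

theorem regularAt_of_dvd {P : Polynomial E} (h : p.denom ∣ P) (hP : P.eval c ≠ 0) :
    RegularAt c p := by
  obtain ⟨r, rfl⟩ := h
  rw [Polynomial.eval_mul] at hP
  exact left_ne_zero_of_mul hP

theorem RegularAt.eval₂_ne_zero (h : RegularAt c p) :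
    Polynomial.eval₂ (RingHom.id E) c p.denom ≠ 0 := h

theorem Spec.add (hp : Spec c p v) (hq : Spec c q w) : Spec c (p + q) (v + w) := by
  refine ⟨regularAt_of_dvd (RatFunc.denom_add_dvd p q) ?_, ?_⟩
  · rw [Polynomial.eval_mul]; exact mul_ne_zero hp.1 hq.1
  · rw [← hp.2, ← hq.2]
    exact RatFunc.eval_add _ _ hp.1.eval₂_ne_zero hq.1.eval₂_ne_zero

theorem Spec.mul (hp : Spec c p v) (hq : Spec c q w) : Spec c (p * q) (v * w) := by
  refine ⟨regularAt_of_dvd (RatFunc.denom_mul_dvd p q) ?_, ?_⟩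
  · rw [Polynomial.eval_mul]; exact mul_ne_zero hp.1 hq.1
  · rw [← hp.2, ← hq.2]
    exact RatFunc.eval_mul _ _ hp.1.eval₂_ne_zero hq.1.eval₂_ne_zero

theorem Spec.const (c a : E) : Spec c (RatFunc.C a) a := by
  refine ⟨?_, ?_⟩
  · simp [RegularAt]
  · simp [value]

theorem Spec.var (c : E) : Spec c RatFunc.X c := by
  refine ⟨?_, ?_⟩
  · simp [RegularAt]
  · simp [value]

theorem Spec.one (c : E) : Spec c 1 1 := by simpa using Spec.const c (1 : E)

theorem Spec.zero (c : E) : Spec c 0 0 := by simpa using Spec.const c (0 : E)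

theorem Spec.neg (hp : Spec c p v) : Spec c (-p) (-v) := by
  have := (Spec.const c (-1 : E)).mul hp
  simpa using this

theorem Spec.sub (hp : Spec c p v) (hq : Spec c q w) : Spec c (p - q) (v - w) := by
  simpa [sub_eq_add_neg] using hp.add hq.neg

theorem Spec.ne_zero (hp : Spec c p v) (hv : v ≠ 0) : p ≠ 0 := by
  rintro rfl
  exact hv (by rw [← hp.2]; simp [value])

theorem Spec.ne (hp : Spec c p v) (hq : Spec c q w) (h : v ≠ w) : p ≠ q := by
  rintro rfl
  exact h (hp.2.symm.trans hq.2)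

theorem Spec.inv (hp : Spec c p v) (hv : v ≠ 0) : Spec c p⁻¹ v⁻¹ := by
  have h0 := hp.ne_zero hv
  have hn : p.num.eval c ≠ 0 := by
    intro h
    apply hv
    rw [← hp.2]
    change Polynomial.eval₂ (RingHom.id E) c p.num / _ = 0
    rw [Polynomial.eval₂_id, h, zero_div]
  have hr : RegularAt c p⁻¹ := regularAt_of_dvd (RatFunc.denom_inv_dvd h0) hn
  refine ⟨hr, ?_⟩
  have h1 : Spec c (p * p⁻¹) (v * value c p⁻¹) := hp.mul ⟨hr, rfl⟩
  rw [mul_inv_cancel₀ h0] at h1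
  have h2 : v * value c p⁻¹ = 1 := h1.2.symm.trans (Spec.one c).2
  exact eq_inv_of_mul_eq_one_right h2

theorem Spec.div (hp : Spec c p v) (hq : Spec c q w) (hw : w ≠ 0) : Spec c (p / q) (v / w) := by
  simpa [div_eq_mul_inv] using hp.mul (hq.inv hw)

/-- The affine path from `a` (at `t = 0`) to `b` (at `t = 1`). -/
noncomputable def segment (a b : E) : RatFunc E :=
  RatFunc.C a + RatFunc.X * (RatFunc.C b - RatFunc.C a)

theorem spec_segment_zero (a b : E) : Spec 0 (segment a b) a := by
  have := (Spec.const 0 a).add ((Spec.var 0).mul ((Spec.const 0 b).sub (Spec.const 0 a)))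
  simpa [segment] using this

theorem spec_segment_one (a b : E) : Spec 1 (segment a b) b := by
  have := (Spec.const 1 a).add ((Spec.var 1).mul ((Spec.const 1 b).sub (Spec.const 1 a)))
  simpa [segment] using this

end Spec

/-! ### Relations obtained by deformation -/

section Deformation

/-- A symbol `[i₀ | i₁, …, iₙ | iₙ₊₁]` in the letters of an index set. -/
abbrev FSymb (ι : Type*) := ι × List ι × ι

variable {ι : Type*} {K : Type u}

/-- The convergence condition for the values of a symbol. -/
def ConvAt (n : ℕ) (x : ι → K) (s : FSymb ι) : Prop :=
  IsConvergent n (x s.1) (s.2.1.map x) (x s.2.2)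

/-- The value of a symbol of letters in `ℚ[K_×^{n+2}]`. -/
noncomputable def symbAt (n : ℕ) (x : ι → K) (s : FSymb ι) : Symb K n →₀ ℚ :=
  symb n (x s.1) (s.2.1.map x) (x s.2.2)

/-- The value of a symbol of letters in `H_n(K)`. -/
noncomputable def hypAt [Field K] (n : ℕ) (x : ι → K) (s : FSymb ι) : H n K :=
  hyp n (x s.1) (s.2.1.map x) (x s.2.2)

/-- The letters of a symbol. -/
def letters (s : FSymb ι) : List ι := s.1 :: s.2.2 :: s.2.1

theorem symb_of_conv {n : ℕ} {a b : K} {w : List K} (h : IsConvergent n a w b) :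
    symb n a w b = Finsupp.single ⟨a, w, b, h⟩ 1 := dif_pos h

theorem symb_of_not_conv {n : ℕ} {a b : K} {w : List K} (h : ¬IsConvergent n a w b) :
    symb n a w b = 0 := dif_neg h

variable {E : Type u} [Field E]

theorem IsConvergent.of_map {n : ℕ} {c : E} {a b : RatFunc E} {w : List (RatFunc E)}
    (h : IsConvergent n (value c a) (w.map (value c)) (value c b)) : IsConvergent n a w b := by
  obtain ⟨h1, h2, h3⟩ := h
  refine ⟨by simpa using h1, fun h => h2 ?_, fun h => h3 ?_⟩
  · rw [List.head?_map, h, Option.map_some]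
  · rw [List.getLast?_map, h, Option.map_some]

theorem map_value_eq {c : E} {X : ι → RatFunc E} {x : ι → E} {w : List ι}
    (h : ∀ i ∈ w, Spec c (X i) (x i)) : (w.map X).map (value c) = w.map x := by
  rw [List.map_map]
  exact List.map_congr_left fun i hi => (h i hi).2

theorem conv_value {n : ℕ} {c : E} {X : ι → RatFunc E} {x : ι → E} {s : FSymb ι}
    (hs : ∀ i ∈ letters s, Spec c (X i) (x i)) (h : ConvAt n x s) :
    IsConvergent n (value c (X s.1)) ((s.2.1.map X).map (value c)) (value c (X s.2.2)) := by
  rw [map_value_eq fun i hi => hs i (by simp [letters, hi]), (hs s.1 (by simp [letters])).2,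
    (hs s.2.2 (by simp [letters])).2]
  exact h

theorem specialize_symbAt {n : ℕ} {c : E} {X : ι → RatFunc E} {x : ι → E} {s : FSymb ι}
    (hs : ∀ i ∈ letters s, Spec c (X i) (x i)) (h : ConvAt n x s) :
    specialize n c (symbAt n X s) = symbAt n x s := by
  rw [symbAt, symb_of_conv (conv_value hs h).of_map, specialize, Finsupp.linearCombination_single,
    one_smul]
  simp only
  rw [map_value_eq fun i hi => hs i (by simp [letters, hi]), (hs s.1 (by simp [letters])).2,
    (hs s.2.2 (by simp [letters])).2, symbAt]

theorem lsum_support {n : ℕ} {X : ι → RatFunc E} {L : List (ℤ × FSymb ι)}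
    {σ : Symb (RatFunc E) n} (hσ : σ ∈ (lsum L (symbAt n X)).support) :
    ∃ t ∈ L, ∃ h, σ = ⟨X t.2.1, t.2.2.1.map X, X t.2.2.2, h⟩ := by
  classical
  induction L with
  | nil => simp at hσ
  | cons t L ih =>
    rw [lsum_cons] at hσ
    rcases Finset.mem_union.1 (Finsupp.support_add hσ) with h | h
    · refine ⟨t, by simp, ?_⟩
      by_cases hc : IsConvergent n (X t.2.1) (t.2.2.1.map X) (X t.2.2.2)
      · rw [symbAt, symb_of_conv hc, Finsupp.smul_single] at h
        exact ⟨hc, Finset.mem_singleton.1 (Finsupp.support_single_subset h)⟩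
      · rw [symbAt, symb_of_not_conv hc] at h
        simp at h
    · obtain ⟨s, hs, h⟩ := ih h
      exact ⟨s, by simp [hs], h⟩

/-- A combination of symbols is constant along a path on which its cobracket vanishes. -/
theorem lsum_hypAt_eq_of_delta (n : ℕ) (L : List (ℤ × FSymb ι)) (x₀ x₁ : ι → E)
    (X : ι → RatFunc E)
    (hc : ∀ t ∈ L, ConvAt (n + 2) x₀ t.2 ∧ ConvAt (n + 2) x₁ t.2)
    (hs : ∀ t ∈ L, ∀ i ∈ letters t.2, Spec 0 (X i) (x₀ i) ∧ Spec 1 (X i) (x₁ i))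
    (hδ : ∀ k : ℕ, 0 < k ∧ 2 * k < n + 2 →
      delta (n + 2) (relations (n + 2 - k) (RatFunc E)) (relations k (RatFunc E))
        (lsum L (symbAt (n + 2) X)) = 0)
    (hw : ∀ k : ℕ, 2 * k = n + 2 →
      deltaWedge (n + 2) (relations k (RatFunc E)) (lsum L (symbAt (n + 2) X)) = 0) :
    lsum L (hypAt (n + 2) x₀) = lsum L (hypAt (n + 2) x₁) := by
  have key : specialize (n + 2) (1 : E) (lsum L (symbAt (n + 2) X)) -
      specialize (n + 2) (0 : E) (lsum L (symbAt (n + 2) X)) ∈ relations (n + 2) E := by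
    rw [relations]
    refine Submodule.subset_span (Or.inr ⟨_, hδ, hw, fun σ hσ => ?_, rfl⟩)
    obtain ⟨t, ht, h, rfl⟩ := lsum_support hσ
    have h0 : ∀ i ∈ letters t.2, Spec 0 (X i) (x₀ i) := fun i hi => (hs t ht i hi).1
    have h1 : ∀ i ∈ letters t.2, Spec 1 (X i) (x₁ i) := fun i hi => (hs t ht i hi).2
    refine ⟨⟨(h0 _ (by simp [letters])).1, ?_, (h0 _ (by simp [letters])).1,
      conv_value h0 (hc t ht).1⟩, ⟨(h1 _ (by simp [letters])).1, ?_,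
      (h1 _ (by simp [letters])).1, conv_value h1 (hc t ht).2⟩⟩
    · intro p hp
      obtain ⟨i, hi, rfl⟩ := List.mem_map.1 hp
      exact (h0 i (by simp [letters, hi])).1
    · intro p hp
      obtain ⟨i, hi, rfl⟩ := List.mem_map.1 hp
      exact (h1 i (by simp [letters, hi])).1
  have h0 : specialize (n + 2) (0 : E) (lsum L (symbAt (n + 2) X)) =
      lsum L (symbAt (n + 2) x₀) := by
    rw [map_lsum]
    exact lsum_congr fun t ht => specialize_symbAt (fun i hi => (hs t ht i hi).1) (hc t ht).1
  have h1 : specialize (n + 2) (1 : E) (lsum L (symbAt (n + 2) X)) =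
      lsum L (symbAt (n + 2) x₁) := by
    rw [map_lsum]
    exact lsum_congr fun t ht => specialize_symbAt (fun i hi => (hs t ht i hi).2) (hc t ht).2
  rw [h0, h1] at key
  have h2 := (Submodule.Quotient.eq (relations (n + 2) E)).2 key
  have h3 : ∀ x : ι → E, lsum L (hypAt (n + 2) x) =
      (relations (n + 2) E).mkQ (lsum L (symbAt (n + 2) x)) := fun x => (map_lsum _ _ _).symm
  rw [h3, h3]
  exact h2.symm

/-- Integrals over a constant path vanish; symbols that do not converge are zero anyway. -/
theorem hyp_constant_path (n : ℕ) (a : E) (w : List E) : hyp (n + 2) a w a = 0 := by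
  by_cases hc : IsConvergent (n + 2) a w a
  · rw [hyp, symb_of_conv hc]
    refine (Submodule.Quotient.mk_eq_zero _).2 ?_
    rw [relations]
    exact Submodule.subset_span (Or.inl ⟨_, rfl, rfl⟩)
  · rw [hyp, symb_of_not_conv hc, map_zero]

end Deformation

/-! ### Weight one -/

section WeightOne

variable {K : Type u} [Field K]

/-- The class of `r ≠ 0` in `H_1(K) = K^× ⊗ ℚ`, and `0` for `r = 0`. -/
noncomputable def lg (r : K) : H 1 K := hyp 1 1 [0] r

@[simp] theorem lg_zero : lg (0 : K) = 0 := by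
  have : ¬IsConvergent 1 (1 : K) [0] 0 := fun h => h.2.2 rfl
  rw [lg, hyp, symb_of_not_conv this, map_zero]

theorem lg_mul {r s : K} (hr : r ≠ 0) (hs : s ≠ 0) : lg (r * s) = lg r + lg s := by
  have hc : ∀ t : K, t ≠ 0 → IsConvergent 1 (1 : K) [0] t := fun t ht =>
    ⟨rfl, by simp, by simpa using ht.symm⟩
  rw [lg, lg, lg, hyp, hyp, hyp, ← map_add]
  refine (Submodule.Quotient.eq _).2 ?_
  rw [relations, LinearMap.mem_ker, map_sub, map_add, symb_of_conv (hc _ (mul_ne_zero hr hs)),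
    symb_of_conv (hc _ hr), symb_of_conv (hc _ hs)]
  simp only [logMap, Finsupp.linearCombination_single, one_smul, List.headD_cons, sub_zero,
    div_one, unitClass, hr, hs, mul_ne_zero hr hs, dite_false]
  rw [← TensorProduct.tmul_add, ← ofMul_mul, sub_eq_zero]
  congr 2
  ext
  rfl

@[simp] theorem lg_one : lg (1 : K) = 0 := by
  have := lg_mul (one_ne_zero (α := K)) one_ne_zero
  simpa using this

@[simp] theorem lg_neg (r : K) : lg (-r) = lg r := by
  have h1 : (2 : ℚ) • lg (-1 : K) = 0 := by
    have := lg_mul (neg_ne_zero.2 (one_ne_zero (α := K))) (neg_ne_zero.2 one_ne_zero)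
    rw [two_smul, ← this]
    simp
  have h2 : lg (-1 : K) = 0 := by simpa using h1
  by_cases hr : r = 0
  · simp [hr]
  · rw [← neg_one_mul, lg_mul (neg_ne_zero.2 one_ne_zero) hr, h2, zero_add]

theorem lg_sub_comm (r s : K) : lg (r - s) = lg (s - r) := by
  rw [← neg_sub, lg_neg]

theorem lg_inv (r : K) : lg r⁻¹ = -lg r := by
  by_cases hr : r = 0
  · simp [hr]
  · rw [eq_neg_iff_add_eq_zero, ← lg_mul (inv_ne_zero hr) hr, inv_mul_cancel₀ hr, lg_one]

theorem lg_div {r s : K} (hr : r ≠ 0) (hs : s ≠ 0) : lg (r / s) = lg r - lg s := by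
  rw [div_eq_mul_inv, lg_mul hr (inv_ne_zero hs), lg_inv, sub_eq_add_neg]

theorem lg_nz (r : K) : lg (nz r) = lg r := by
  unfold nz
  split_ifs with h
  · simp [h]
  · rfl

theorem nz_ne_zero (r : K) : nz r ≠ 0 := by
  unfold nz
  split_ifs with h
  · exact one_ne_zero
  · exact h

/-- In weight one the formula holds for the regularized symbols too, as `lg 0 = 0`. -/
theorem cls_one (a x b : K) : cls (relations 1 K) a [x] b = lg (b - x) - lg (a - x) := by
  have : cls (relations 1 K) a [x] b = lg (nz (b - x) / nz (a - x)) := rfl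
  rw [this, lg_div (nz_ne_zero _) (nz_ne_zero _), lg_nz, lg_nz]

end WeightOne

/-! ### Weight two -/

section WeightTwo

variable {K : Type u} [Field K]

/-- The component in `Λ² H_k` of the cobracket of a symbol; the sum is that of the coproduct. -/
theorem deltaWedge_symb {k : ℕ} (n : ℕ) (R : Submodule ℚ (Symb K k →₀ ℚ)) {a b : K} {w : List K}
    (h : IsConvergent n a w b) :
    deltaWedge n R (symb n a w b) = ∑ i ∈ Finset.range (k + 1),
      ExteriorAlgebra.ι ℚ (cls R a (w.take i ++ w.drop (i + k)) b) *
      ExteriorAlgebra.ι ℚ (cls R ((a :: w).getD i 0) ((w.drop i).take k)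
        ((w ++ [b]).getD (i + k) 0)) := by
  simp [deltaWedge, coprodLin, symb_of_conv h, coprod]

theorem conv_two {K : Type u} {a x y b : K} : IsConvergent 2 a [x, y] b ↔ a ≠ x ∧ y ≠ b := by
  simp [IsConvergent, eq_comm]

/-- The cyclic sum `α ∧ β + β ∧ γ + γ ∧ α`. -/
noncomputable def cyclicWedge (α β γ : H 1 K) : ExteriorAlgebra ℚ (H 1 K) :=
  ExteriorAlgebra.ι ℚ α * ExteriorAlgebra.ι ℚ β + ExteriorAlgebra.ι ℚ β * ExteriorAlgebra.ι ℚ γ +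
    ExteriorAlgebra.ι ℚ γ * ExteriorAlgebra.ι ℚ α

theorem ι_mul_comm {M : Type*} [AddCommGroup M] [Module ℚ M] (x y : M) :
    ExteriorAlgebra.ι ℚ y * ExteriorAlgebra.ι ℚ x =
      -(ExteriorAlgebra.ι ℚ x * ExteriorAlgebra.ι ℚ y) :=
  eq_neg_of_add_eq_zero_left (ExteriorAlgebra.ι_add_mul_swap y x)

theorem deltaWedge_two {a x y b : K} (h : IsConvergent 2 a [x, y] b) :
    deltaWedge 2 (relations 1 K) (symb 2 a [x, y] b) =
      ExteriorAlgebra.ι ℚ (lg (b - y) - lg (a - y)) * ExteriorAlgebra.ι ℚ (lg (y - x) - lg (a - x))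
      + ExteriorAlgebra.ι ℚ (lg (b - x) - lg (a - x)) *
        ExteriorAlgebra.ι ℚ (lg (b - y) - lg (x - y)) := by
  rw [deltaWedge_symb 2 _ h]
  simp [Finset.sum_range_succ, cls_one]

theorem deltaWedge_two' {x y z : K} (h : IsConvergent 2 y [x, y] z) :
    deltaWedge 2 (relations 1 K) (symb 2 y [x, y] z) =
      -cyclicWedge (lg (x - y)) (lg (y - z)) (lg (z - x)) := by
  rw [deltaWedge_two h, cyclicWedge, lg_sub_comm y x, lg_sub_comm z y]
  simp only [sub_self, lg_zero, map_sub, map_zero, mul_zero, mul_sub, sub_mul, zero_add]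
  rw [ExteriorAlgebra.ι_sq_zero]
  rw [ι_mul_comm (lg (y - z)) (lg (z - x))]
  abel

/-- The dilogarithm `F(x, y, z)` of three points of the affine line; it represents the alternating
dilogarithm of the cross-ratio of `x, y, z, ∞`, and vanishes if two of the points are equal. -/
noncomputable def dilog (x y z : K) : H 2 K := -hyp 2 y [x, y] z

theorem dilog_eq_zero {x y z : K} (h : x = y ∨ y = z) : dilog x y z = 0 := by
  have : ¬IsConvergent 2 y [x, y] z := by
    rw [conv_two]; rintro ⟨h1, h2⟩
    rcases h with h | h
    · exact h1 h.symm
    · exact h2 h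
  rw [dilog, hyp, symb_of_not_conv this, map_zero, neg_zero]

/-- In weight two a combination of symbols is constant along every path whose generic point
is killed by the cobracket. -/
theorem lsum_two_eq {ι : Type*} (L : List (ℤ × FSymb ι)) (x₀ x₁ : ι → K) (X : ι → RatFunc K)
    (hc : ∀ t ∈ L, ConvAt 2 x₀ t.2 ∧ ConvAt 2 x₁ t.2)
    (hs : ∀ i, Spec 0 (X i) (x₀ i) ∧ Spec 1 (X i) (x₁ i))
    (hδ : deltaWedge 2 (relations 1 (RatFunc K)) (lsum L (symbAt 2 X)) = 0) :
    lsum L (hypAt 2 x₀) = lsum L (hypAt 2 x₁) := by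
  refine lsum_hypAt_eq_of_delta 0 L x₀ x₁ X hc (fun t _ i _ => hs i) (fun k hk => ?_) fun k hk => ?_
  · omega
  · obtain rfl : k = 1 := by omega
    exact hδ

theorem conv_of_spec {ι : Type*} {n : ℕ} {c : K} {x : ι → K} {X : ι → RatFunc K} {s : FSymb ι}
    (h : ConvAt n x s) (hs : ∀ i ∈ letters s, Spec c (X i) (x i)) : ConvAt n X s :=
  (conv_value hs h).of_map

theorem wedge_decomposition (ab bc cd ac bd : H 1 K) :
    ExteriorAlgebra.ι ℚ (cd - ac) * ExteriorAlgebra.ι ℚ (bc - ab)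
      + ExteriorAlgebra.ι ℚ (bd - ab) * ExteriorAlgebra.ι ℚ (cd - bc)
      - cyclicWedge ab bc ac + cyclicWedge bc cd bd = 0 := by
  simp only [cyclicWedge, map_sub, mul_sub, sub_mul]
  rw [ι_mul_comm ab ac, ι_mul_comm bc cd, ι_mul_comm ab cd, ι_mul_comm bc ac, ι_mul_comm bd cd]
  abel

/-- A symbol of weight two and its expression by dilogarithms have the same cobracket, so that their
difference does not depend on the points. -/
theorem hyp_two_sub_dilog_const {a b c d a' b' c' d' : K} (h1 : a ≠ b) (h2 : b ≠ c) (h3 : c ≠ d)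
    (h1' : a' ≠ b') (h2' : b' ≠ c') (h3' : c' ≠ d') :
    hyp 2 a [b, c] d - dilog a b c + dilog b c d =
      hyp 2 a' [b', c'] d' - dilog a' b' c' + dilog b' c' d' := by
  let L : List (ℤ × FSymb (Fin 4)) := [(1, (0, [1, 2], 3)), (1, (1, [0, 1], 2)), (-1, (2, [1, 2], 3))]
  have hs : ∀ i : Fin 4, Spec 0 (segment (![a, b, c, d] i) (![a', b', c', d'] i)) (![a, b, c, d] i) ∧
      Spec 1 (segment (![a, b, c, d] i) (![a', b', c', d'] i)) (![a', b', c', d'] i) :=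
    fun i => ⟨spec_segment_zero _ _, spec_segment_one _ _⟩
  have hc : ∀ t ∈ L, ConvAt 2 ![a, b, c, d] t.2 := by
    simp [L, ConvAt, conv_two, h1, h2, h3, h1.symm, h2.symm]
  have hc' : ∀ t ∈ L, ConvAt 2 ![a', b', c', d'] t.2 := by
    simp [L, ConvAt, conv_two, h1', h2', h3', h1'.symm, h2'.symm]
  have := lsum_two_eq L ![a, b, c, d] ![a', b', c', d'] _ (fun t ht => ⟨hc t ht, hc' t ht⟩) hs ?_
  · simp only [L, lsum_cons, lsum_nil, hypAt, List.map_cons, List.map_nil] at this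
    simp only [dilog]
    simpa [sub_eq_add_neg, add_assoc] using this
  · have hcX : ∀ t ∈ L, ConvAt 2 _ t.2 := fun t ht => conv_of_spec (hc t ht) fun i _ => (hs i).1
    generalize (fun i => segment (![a, b, c, d] i) (![a', b', c', d'] i)) = X at hcX ⊢
    have k1 := hcX _ (by simp [L] : (1, (0, [1, 2], 3)) ∈ L)
    have k2 := hcX _ (by simp [L] : (1, (1, [0, 1], 2)) ∈ L)
    have k3 := hcX _ (by simp [L] : (-1, (2, [1, 2], 3)) ∈ L)
    simp only [ConvAt, List.map_cons, List.map_nil] at k1 k2 k3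
    rw [map_lsum]
    simp only [L, lsum_cons, lsum_nil, symbAt, List.map_cons, List.map_nil,
      deltaWedge_two k1, deltaWedge_two' k2, deltaWedge_two' k3]
    have := wedge_decomposition (lg (X 0 - X 1)) (lg (X 1 - X 2)) (lg (X 2 - X 3)) (lg (X 2 - X 0))
      (lg (X 3 - X 1))
    rw [lg_sub_comm (X 3) (X 2), lg_sub_comm (X 0) (X 2), lg_sub_comm (X 2) (X 1)]
    refine Eq.trans ?_ this
    simp only [one_smul, neg_smul, neg_neg]
    abel

/-- Combinations of dilogarithms of points that depend on a parameter are constant if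
the cyclic wedges that represent their cobrackets cancel. -/
theorem lsum_dilog_eq {ι : Type*} (L : List (ℤ × (ι × ι × ι))) (x₀ x₁ : ι → K)
    (X : ι → RatFunc K)
    (hc : ∀ t ∈ L, (x₀ t.2.1 ≠ x₀ t.2.2.1 ∧ x₀ t.2.2.1 ≠ x₀ t.2.2.2) ∧
      (x₁ t.2.1 ≠ x₁ t.2.2.1 ∧ x₁ t.2.2.1 ≠ x₁ t.2.2.2))
    (hs : ∀ i, Spec 0 (X i) (x₀ i) ∧ Spec 1 (X i) (x₁ i))
    (hδ : lsum L (fun s => cyclicWedge (lg (X s.1 - X s.2.1)) (lg (X s.2.1 - X s.2.2))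
      (lg (X s.2.2 - X s.1))) = 0) :
    lsum L (fun s => dilog (x₀ s.1) (x₀ s.2.1) (x₀ s.2.2)) =
      lsum L (fun s => dilog (x₁ s.1) (x₁ s.2.1) (x₁ s.2.2)) := by
  let L' : List (ℤ × FSymb ι) := L.map fun t => (t.1, (t.2.2.1, [t.2.1, t.2.2.1], t.2.2.2))
  have hL : ∀ {M : Type u} [AddCommGroup M] (v : FSymb ι → M), lsum L' v =
      lsum L fun s => v (s.2.1, [s.1, s.2.1], s.2.2) := by
    intro M _ v
    simp [L', lsum, Function.comp_def]
  have hconv : ∀ t ∈ L', ConvAt 2 x₀ t.2 ∧ ConvAt 2 x₁ t.2 := by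
    intro t ht
    obtain ⟨s, hs', rfl⟩ := List.mem_map.1 ht
    obtain ⟨⟨h1, h2⟩, h3, h4⟩ := hc s hs'
    exact ⟨conv_two.2 ⟨h1.symm, h2⟩, conv_two.2 ⟨h3.symm, h4⟩⟩
  have := lsum_two_eq L' x₀ x₁ X hconv hs ?_
  · rw [hL, hL] at this
    have h2 : ∀ x : ι → K, lsum L (fun s => dilog (x s.1) (x s.2.1) (x s.2.2)) =
        -lsum L fun s => hypAt 2 x (s.2.1, [s.1, s.2.1], s.2.2) := by
      intro x
      rw [← lsum_neg]
      rfl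
    rw [h2, h2, this]
  · rw [map_lsum, hL, ← neg_eq_zero, ← hδ]
    rw [← lsum_neg]
    refine lsum_congr fun t ht => ?_
    have ht' := (hconv _ (List.mem_map.2 ⟨t, ht, rfl⟩)).1
    have h3 := conv_of_spec ht' fun i _ => (hs i).1
    change -(deltaWedge 2 _ (symb 2 (X t.2.2.1) [X t.2.1, X t.2.2.1] (X t.2.2.2))) = _
    rw [deltaWedge_two' h3, neg_neg]

theorem cyclicWedge_add (α β γ l : H 1 K) :
    cyclicWedge (l + α) (l + β) (l + γ) = cyclicWedge α β γ := by
  simp only [cyclicWedge, map_add, mul_add, add_mul, ExteriorAlgebra.ι_sq_zero]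
  rw [ι_mul_comm l α, ι_mul_comm l β, ι_mul_comm l γ]
  abel

/-- The cobracket of the five-term relation; `a, b, c, d, e, f` are the logarithms of the differences
of four points, and the first term belongs to their inverses. -/
theorem cyclicWedge_five (a b c d e f : H 1 K) :
    cyclicWedge (a - (d + e)) (c - (e + f)) (b - (f + d)) - cyclicWedge a c b
      + cyclicWedge a e d - cyclicWedge f d b + cyclicWedge c f e = 0 := by
  simp only [cyclicWedge, map_sub, map_add, mul_sub, sub_mul, mul_add, add_mul,
    ExteriorAlgebra.ι_sq_zero]
  rw [ι_mul_comm a b, ι_mul_comm a d, ι_mul_comm a f,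
    ι_mul_comm b c, ι_mul_comm b d, ι_mul_comm b e, ι_mul_comm b f, ι_mul_comm c d,
    ι_mul_comm c e, ι_mul_comm d e, ι_mul_comm d f, ι_mul_comm e f]
  abel

theorem lg_inv_sub_inv {p q u : K} (hpq : p ≠ q) (hp : p ≠ u) (hq : q ≠ u) :
    lg ((p - u)⁻¹ - (q - u)⁻¹) = lg (p - q) - (lg (p - u) + lg (q - u)) := by
  have hp' := sub_ne_zero.2 hp
  have hq' := sub_ne_zero.2 hq
  have : (p - u)⁻¹ - (q - u)⁻¹ = (q - p) / ((p - u) * (q - u)) := by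
    field_simp; ring
  rw [this, lg_div (sub_ne_zero.2 hpq.symm) (mul_ne_zero hp' hq'), lg_mul hp' hq', lg_sub_comm q p]

theorem cyclicWedge_zero_inv (a b c : H 1 K) :
    cyclicWedge (-b) (-a) (c - (a + b)) + cyclicWedge b a c = 0 := by
  simp only [cyclicWedge, map_sub, map_add, map_neg, mul_sub, sub_mul, mul_add, add_mul, mul_neg,
    neg_mul, ExteriorAlgebra.ι_sq_zero]
  rw [ι_mul_comm a b]
  abel

instance infinite_ratFunc : Infinite (RatFunc K) :=
  Infinite.of_injective _ (RatFunc.algebraMap_injective K)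

variable [Infinite K]

theorem hyp_two_eq {a b c d : K} (h1 : a ≠ b) (h2 : b ≠ c) (h3 : c ≠ d) :
    hyp 2 a [b, c] d = dilog a b c - dilog b c d := by
  classical
  obtain ⟨x, -⟩ := Infinite.exists_notMem_finset (∅ : Finset K)
  obtain ⟨y, hy⟩ := Infinite.exists_notMem_finset {x}
  obtain ⟨z, hz⟩ := Infinite.exists_notMem_finset {x, y}
  have hxy : x ≠ y := fun h => hy (by simp [h])
  have hxz : x ≠ z := fun h => hz (by simp [h])
  have hyz : y ≠ z := fun h => hz (by simp [h])
  -- for constant paths `[x | y, z | x]` the dilogarithms cancel in the sum over the three cyclic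
  -- permutations of `x, y, z`, so that three times the constant is zero
  have e1 := hyp_two_sub_dilog_const h1 h2 h3 hxy hyz hxz.symm
  have e2 := hyp_two_sub_dilog_const h1 h2 h3 hyz hxz.symm hxy
  have e3 := hyp_two_sub_dilog_const h1 h2 h3 hxz.symm hxy hyz
  rw [hyp_constant_path 0] at e1 e2 e3
  set t := hyp 2 a [b, c] d - dilog a b c + dilog b c d with ht
  have h3t : (3 : ℚ) • t = 0 := by
    have : t + t + t = 0 := by
      nth_rewrite 1 [e1]; nth_rewrite 1 [e2]; rw [e3]; abel
    rw [← this]; module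
  have h0 : t = 0 := by simpa using h3t
  rw [ht] at h0
  rw [← sub_eq_zero, ← h0]
  abel

theorem dilog_outer (a b : K) : dilog a b a = 0 := by
  classical
  by_cases h : a = b
  · exact dilog_eq_zero (Or.inl h)
  · obtain ⟨d, hd⟩ := Infinite.exists_notMem_finset {a}
    have := hyp_two_eq h (Ne.symm h) (fun h => hd (by simp [h]) : a ≠ d)
    have h2 : dilog b a d = -hyp 2 a [b, a] d := rfl
    rw [h2, sub_neg_eq_add] at this
    simpa using this

theorem dilog_rotate (x y z : K) : dilog x y z = dilog y z x := by
  by_cases hxy : x = y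
  · subst hxy; rw [dilog_eq_zero (Or.inl rfl), dilog_outer]
  by_cases hyz : y = z
  · subst hyz; rw [dilog_eq_zero (Or.inr rfl), dilog_eq_zero (Or.inl rfl)]
  by_cases hzx : z = x
  · subst hzx; rw [dilog_outer, dilog_eq_zero (Or.inr rfl)]
  have := hyp_two_eq hxy hyz hzx
  rw [hyp_constant_path 0] at this
  exact (sub_eq_zero.1 this.symm)

/-- The sum of both sides has the cobracket zero, and vanishes when `z` is moved to `x`. -/
theorem dilog_swap (x y z : K) : dilog z y x = -dilog x y z := by
  by_cases hxy : x = y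
  · rw [dilog_eq_zero (Or.inl hxy), dilog_eq_zero (Or.inr hxy.symm), neg_zero]
  by_cases hyz : y = z
  · rw [dilog_eq_zero (Or.inr hyz), dilog_eq_zero (Or.inl hyz.symm), neg_zero]
  have := lsum_dilog_eq (ι := Fin 3) [(1, (0, 1, 2)), (1, (2, 1, 0))] ![x, y, z] ![x, y, x]
    ![RatFunc.C x, RatFunc.C y, segment z x] ?_ ?_ ?_
  · simp only [lsum_cons, lsum_nil, one_smul, add_zero] at this
    change dilog x y z + dilog z y x = dilog x y x + dilog x y x at this
    rw [dilog_outer, add_zero] at this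
    exact eq_neg_of_add_eq_zero_right this
  · simp [hxy, hyz, Ne.symm hxy, Ne.symm hyz]
  · intro i
    fin_cases i
    exacts [⟨Spec.const _ _, Spec.const _ _⟩, ⟨Spec.const _ _, Spec.const _ _⟩,
      ⟨spec_segment_zero _ _, spec_segment_one _ _⟩]
  · generalize ![RatFunc.C x, RatFunc.C y, segment z x] = X
    simp only [lsum_cons, lsum_nil, one_smul, add_zero, cyclicWedge]
    rw [lg_sub_comm (X 1) (X 0), lg_sub_comm (X 2) (X 1), lg_sub_comm (X 0) (X 2)]
    rw [ι_mul_comm (lg (X 0 - X 1)) (lg (X 1 - X 2)), ι_mul_comm (lg (X 2 - X 0)) (lg (X 0 - X 1)),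
      ι_mul_comm (lg (X 1 - X 2)) (lg (X 2 - X 0))]
    abel

theorem dilog_swap_left (x y z : K) : dilog y x z = -dilog x y z := by
  rw [dilog_swap z x y, dilog_rotate z x y]

theorem dilog_swap_right (x y z : K) : dilog x z y = -dilog x y z := by
  rw [dilog_rotate x z y, dilog_swap x y z]

/-- Both sides have the same cobracket, and both vanish when `z` is moved to `x`. -/
theorem dilog_affine {l : K} (hl : l ≠ 0) (m x y z : K) :
    dilog (m + l * x) (m + l * y) (m + l * z) = dilog x y z := by
  have hinj : ∀ {a b : K}, m + l * a = m + l * b ↔ a = b := by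
    intro a b; simp [hl]
  by_cases hxy : x = y
  · rw [dilog_eq_zero (Or.inl hxy), dilog_eq_zero (Or.inl (hinj.2 hxy))]
  by_cases hyz : y = z
  · rw [dilog_eq_zero (Or.inr hyz), dilog_eq_zero (Or.inr (hinj.2 hyz))]
  let φ : RatFunc K → RatFunc K := fun a => RatFunc.C m + RatFunc.C l * a
  have hφ : ∀ {c v : K} {a : RatFunc K}, Spec c a v → Spec c (φ a) (m + l * v) :=
    fun h => (Spec.const _ _).add ((Spec.const _ _).mul h)
  have := lsum_dilog_eq (ι := Fin 6) [(1, (3, 4, 5)), (-1, (0, 1, 2))]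
    ![x, y, z, m + l * x, m + l * y, m + l * z] ![x, y, x, m + l * x, m + l * y, m + l * x]
    ![RatFunc.C x, RatFunc.C y, segment z x, φ (RatFunc.C x), φ (RatFunc.C y), φ (segment z x)]
    ?_ ?_ ?_
  · simp only [lsum_cons, lsum_nil, one_smul, add_zero, neg_smul, ← sub_eq_add_neg] at this
    change dilog (m + l * x) (m + l * y) (m + l * z) - dilog x y z =
      dilog (m + l * x) (m + l * y) (m + l * x) - dilog x y x at this
    rw [dilog_outer, dilog_outer, sub_zero] at this
    exact sub_eq_zero.1 this
  · have h1 := mt hinj.1 hxy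
    have h2 := mt hinj.1 hyz
    have h3 := mt hinj.1 (Ne.symm hxy)
    intro t ht
    simp only [List.mem_cons, List.not_mem_nil, or_false] at ht
    rcases ht with rfl | rfl
    exacts [⟨⟨h1, h2⟩, h1, h3⟩, ⟨⟨hxy, hyz⟩, hxy, Ne.symm hxy⟩]
  · intro i
    fin_cases i
    exacts [⟨Spec.const _ _, Spec.const _ _⟩, ⟨Spec.const _ _, Spec.const _ _⟩,
      ⟨spec_segment_zero _ _, spec_segment_one _ _⟩, ⟨hφ (Spec.const _ _), hφ (Spec.const _ _)⟩,
      ⟨hφ (Spec.const _ _), hφ (Spec.const _ _)⟩,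
      ⟨hφ (spec_segment_zero _ _), hφ (spec_segment_one _ _)⟩]
  · have hlg : ∀ a b : RatFunc K, a ≠ b → lg (φ a - φ b) = lg (RatFunc.C l) + lg (a - b) := by
      intro a b hab
      rw [← lg_mul _ (sub_ne_zero.2 hab)]
      · congr 1; simp only [φ]; ring
      · simpa using hl
    have h1 : RatFunc.C x ≠ RatFunc.C y := fun h => hxy (RatFunc.C_injective h)
    have h2 : RatFunc.C y ≠ segment z x := (Spec.const 0 y).ne (spec_segment_zero z x) hyz
    simp only [lsum_cons, lsum_nil, one_smul, add_zero, neg_smul, ← sub_eq_add_neg]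
    change cyclicWedge (lg (φ (RatFunc.C x) - φ (RatFunc.C y)))
        (lg (φ (RatFunc.C y) - φ (segment z x))) (lg (φ (segment z x) - φ (RatFunc.C x))) -
      cyclicWedge (lg (RatFunc.C x - RatFunc.C y)) (lg (RatFunc.C y - segment z x))
        (lg (segment z x - RatFunc.C x)) = 0
    by_cases h3 : segment z x = RatFunc.C x
    · simp only [h3, sub_self, lg_zero, cyclicWedge, map_zero, mul_zero, zero_mul, add_zero]
      rw [lg_sub_comm (φ (RatFunc.C y)), lg_sub_comm (RatFunc.C y), ExteriorAlgebra.ι_sq_zero,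
        ExteriorAlgebra.ι_sq_zero, sub_zero]
    · rw [hlg _ _ h1, hlg _ _ h2, hlg _ _ h3, cyclicWedge_add, sub_self]

/-- The five-term relation for the points `p, q, r, u, ∞`. -/
theorem dilog_inv {p q r u : K} (hp : p ≠ u) (hq : q ≠ u) (hr : r ≠ u) :
    dilog (p - u)⁻¹ (q - u)⁻¹ (r - u)⁻¹ =
      dilog p q r - dilog p q u + dilog p r u - dilog q r u := by
  have hinj : ∀ {a b : K}, (a - u)⁻¹ = (b - u)⁻¹ ↔ a = b := by
    intro a b; simp
  by_cases hpq : p = q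
  · subst hpq; simp [dilog_eq_zero]
  by_cases hqr : q = r
  · subst hqr; simp [dilog_eq_zero]
  have hpq' := mt hinj.1 hpq
  have hqr' := mt hinj.1 hqr
  have hqp' := Ne.symm hpq'
  let s := segment p r
  let C : K →+* RatFunc K := RatFunc.C
  have := lsum_dilog_eq (ι := Fin 7) [(1, (4, 5, 6)), (-1, (0, 1, 2)), (1, (0, 1, 3)),
      (-1, (2, 3, 0)), (1, (1, 2, 3))]
    ![p, q, r, u, (p - u)⁻¹, (q - u)⁻¹, (r - u)⁻¹] ![r, q, r, u, (r - u)⁻¹, (q - u)⁻¹, (r - u)⁻¹]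
    ![s, C q, C r, C u, (s - C u)⁻¹, (C q - C u)⁻¹, (C r - C u)⁻¹] ?_ ?_ ?_
  · simp only [lsum_cons, lsum_nil, one_smul, add_zero, neg_smul] at this
    change dilog (p - u)⁻¹ (q - u)⁻¹ (r - u)⁻¹ + (-dilog p q r + (dilog p q u +
        (-dilog r u p + dilog q r u))) =
      dilog (r - u)⁻¹ (q - u)⁻¹ (r - u)⁻¹ + (-dilog r q r + (dilog r q u +
        (-dilog r u r + dilog q r u))) at this
    rw [dilog_outer, dilog_outer, dilog_outer, dilog_swap_left q r u, ← dilog_rotate p r u] at this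
    rw [← sub_eq_zero]
    simp only [neg_zero, add_zero, zero_add, neg_add_cancel] at this
    rw [← this]
    abel
  · intro t ht
    simp only [List.mem_cons, List.not_mem_nil, or_false] at ht
    rcases ht with rfl | rfl | rfl | rfl | rfl
    exacts [⟨⟨hpq', hqr'⟩, Ne.symm hqr', hqr'⟩, ⟨⟨hpq, hqr⟩, Ne.symm hqr, hqr⟩,
      ⟨⟨hpq, hq⟩, Ne.symm hqr, hq⟩, ⟨⟨hr, hp.symm⟩, hr, hr.symm⟩, ⟨⟨hqr, hr⟩, hqr, hr⟩]
  · have hC : ∀ c a : K, Spec c (C a) a := Spec.const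
    have hi : ∀ {c v : K} {a : RatFunc K}, Spec c a v → v ≠ u → Spec c (a - C u)⁻¹ (v - u)⁻¹ :=
      fun h hv => (h.sub (hC _ _)).inv (sub_ne_zero.2 hv)
    intro i
    fin_cases i
    exacts [⟨spec_segment_zero _ _, spec_segment_one _ _⟩, ⟨hC _ _, hC _ _⟩, ⟨hC _ _, hC _ _⟩,
      ⟨hC _ _, hC _ _⟩, ⟨hi (spec_segment_zero _ _) hp, hi (spec_segment_one _ _) hr⟩,
      ⟨hi (hC _ _) hq, hi (hC _ _) hq⟩, ⟨hi (hC _ _) hr, hi (hC _ _) hr⟩]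
  · have hC : ∀ {a b : K}, a ≠ b → C a ≠ C b := fun h h' => h (RatFunc.C_injective h')
    have hsq : s ≠ C q := (spec_segment_zero p r).ne (Spec.const 0 q) hpq
    have hsu : s ≠ C u := (spec_segment_zero p r).ne (Spec.const 0 u) hp
    simp only [lsum_cons, lsum_nil, one_smul, add_zero, neg_smul]
    change cyclicWedge (lg ((s - C u)⁻¹ - (C q - C u)⁻¹)) (lg ((C q - C u)⁻¹ - (C r - C u)⁻¹))
        (lg ((C r - C u)⁻¹ - (s - C u)⁻¹)) + (-cyclicWedge (lg (s - C q)) (lg (C q - C r))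
        (lg (C r - s)) + (cyclicWedge (lg (s - C q)) (lg (C q - C u)) (lg (C u - s)) +
        (-cyclicWedge (lg (C r - C u)) (lg (C u - s)) (lg (s - C r)) +
        cyclicWedge (lg (C q - C r)) (lg (C r - C u)) (lg (C u - C q))))) = 0
    by_cases hsr : s = C r
    · rw [hsr, sub_self, sub_self, lg_zero, lg_sub_comm (C q) (C r), lg_sub_comm (C u) (C r),
        lg_sub_comm (C u) (C q), lg_sub_comm (C q - C u)⁻¹]
      simp only [cyclicWedge, map_zero, mul_zero, zero_mul, add_zero, ExteriorAlgebra.ι_sq_zero]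
      rw [ι_mul_comm (lg (C r - C q)) (lg (C q - C u)),
        ι_mul_comm (lg (C r - C u)) (lg (C r - C q)), ι_mul_comm (lg (C q - C u)) (lg (C r - C u))]
      abel
    · rw [lg_inv_sub_inv hsq hsu (hC hq), lg_inv_sub_inv (hC hqr) (hC hq) (hC hr),
        lg_inv_sub_inv (Ne.symm hsr) (hC hr) hsu]
      have := cyclicWedge_five (lg (s - C q)) (lg (s - C r)) (lg (C q - C r)) (lg (s - C u))
        (lg (C q - C u)) (lg (C r - C u))
      rw [lg_sub_comm (C r) s, lg_sub_comm (C u) s, lg_sub_comm (C u) (C q)]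
      rw [← this]
      abel

/-- The limiting case of `dilog_inv` in which the first point is at infinity. -/
theorem dilog_zero_inv {q r u : K} (hq : q ≠ u) (hr : r ≠ u) :
    dilog 0 (q - u)⁻¹ (r - u)⁻¹ = -dilog q r u := by
  by_cases hqr : q = r
  · subst hqr; simp [dilog_eq_zero]
  have hq0 : (q - u)⁻¹ ≠ 0 := inv_ne_zero (sub_ne_zero.2 hq)
  have hr0 : (r - u)⁻¹ ≠ 0 := inv_ne_zero (sub_ne_zero.2 hr)
  let s := segment q r
  let C : K →+* RatFunc K := RatFunc.C
  have := lsum_dilog_eq (ι := Fin 6) [(1, (5, 3, 4)), (1, (2, 1, 0))]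
    ![q, u, r, 0, (q - u)⁻¹, (r - u)⁻¹] ![r, u, r, 0, (r - u)⁻¹, (r - u)⁻¹]
    ![s, C u, C r, 0, (s - C u)⁻¹, (C r - C u)⁻¹] ?_ ?_ ?_
  · simp only [lsum_cons, lsum_nil, one_smul, add_zero] at this
    change dilog (r - u)⁻¹ 0 (q - u)⁻¹ + dilog r u q =
      dilog (r - u)⁻¹ 0 (r - u)⁻¹ + dilog r u r at this
    rw [dilog_outer, dilog_outer, add_zero, dilog_rotate, ← dilog_rotate q r u] at this
    exact eq_neg_of_add_eq_zero_left this
  · intro t ht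
    simp only [List.mem_cons, List.not_mem_nil, or_false] at ht
    rcases ht with rfl | rfl
    exacts [⟨⟨hr0, hq0.symm⟩, hr0, hr0.symm⟩, ⟨⟨hr, hq.symm⟩, hr, hr.symm⟩]
  · have hC : ∀ c a : K, Spec c (C a) a := Spec.const
    have hi : ∀ {c v : K} {a : RatFunc K}, Spec c a v → v ≠ u → Spec c (a - C u)⁻¹ (v - u)⁻¹ :=
      fun h hv => (h.sub (hC _ _)).inv (sub_ne_zero.2 hv)
    intro i
    fin_cases i
    exacts [⟨spec_segment_zero _ _, spec_segment_one _ _⟩, ⟨hC _ _, hC _ _⟩, ⟨hC _ _, hC _ _⟩,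
      ⟨Spec.zero _, Spec.zero _⟩, ⟨hi (spec_segment_zero _ _) hq, hi (spec_segment_one _ _) hr⟩,
      ⟨hi (hC _ _) hr, hi (hC _ _) hr⟩]
  · have hru : C r ≠ C u := fun h => hr (RatFunc.C_injective h)
    have hsu : s ≠ C u := (spec_segment_zero q r).ne (Spec.const 0 u) hq
    have hsr : s ≠ C r := (spec_segment_zero q r).ne (Spec.const 0 r) hqr
    simp only [lsum_cons, lsum_nil, one_smul, add_zero]
    change cyclicWedge (lg ((C r - C u)⁻¹ - 0)) (lg (0 - (s - C u)⁻¹))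
        (lg ((s - C u)⁻¹ - (C r - C u)⁻¹)) +
      cyclicWedge (lg (C r - C u)) (lg (C u - s)) (lg (s - C r)) = 0
    rw [sub_zero, zero_sub, lg_neg, lg_inv, lg_inv, lg_inv_sub_inv hsr hsu hru,
      lg_sub_comm (C u) s, cyclicWedge_zero_inv]

omit [Infinite K] in
/-- The squares of logarithms vanish: the cobracket is zero, and `b` can be moved to `a`. -/
theorem hyp_two_repeat {a x b : K} (ha : a ≠ x) (hb : x ≠ b) : hyp 2 a [x, x] b = 0 := by
  have hc : ∀ t ∈ [((1 : ℤ), ((0, [1, 1], 2) : FSymb (Fin 3)))], ConvAt 2 ![a, x, b] t.2 := by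
    simp [ConvAt, conv_two, ha, hb]
  have hc' : ∀ t ∈ [((1 : ℤ), ((0, [1, 1], 2) : FSymb (Fin 3)))], ConvAt 2 ![a, x, a] t.2 := by
    simp [ConvAt, conv_two, ha, ha.symm]
  have hs : ∀ i : Fin 3, Spec 0 (segment (![a, x, b] i) (![a, x, a] i)) (![a, x, b] i) ∧
      Spec 1 (segment (![a, x, b] i) (![a, x, a] i)) (![a, x, a] i) :=
    fun i => ⟨spec_segment_zero _ _, spec_segment_one _ _⟩
  have := lsum_two_eq _ ![a, x, b] ![a, x, a] _ (fun t ht => ⟨hc t ht, hc' t ht⟩) hs ?_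
  · simp only [lsum_cons, lsum_nil, one_smul, add_zero] at this
    change hyp 2 a [x, x] b = hyp 2 a [x, x] a at this
    rw [this, hyp_constant_path 0]
  · have hcX := conv_of_spec (hc (1, (0, [1, 1], 2)) (by simp)) fun i _ => (hs i).1
    generalize (fun i => segment (![a, x, b] i) (![a, x, a] i)) = X at hcX ⊢
    simp only [lsum_cons, lsum_nil, one_smul, add_zero]
    change deltaWedge 2 _ (symb 2 (X 0) [X 1, X 1] (X 2)) = 0
    rw [deltaWedge_two hcX, sub_self, lg_zero, zero_sub, sub_zero, ← mul_add, ← map_add,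
      neg_add_eq_sub, ExteriorAlgebra.ι_sq_zero]

omit [Infinite K] in
theorem reg_two (a b : K) (w : List K) : reg 2 a w b = regShuffle 2 a w b := by
  rcases w with _ | ⟨x, _ | ⟨y, w⟩⟩ <;> rfl

omit [Field K] [Infinite K] in
theorem regLeft_of_ne {a : K} {w : List K} (h : w.head? ≠ some a) (h0 : w ≠ []) :
    regLeft a w = Finsupp.single w 1 := by
  obtain _ | ⟨c, v⟩ := w
  · exact absurd rfl h0
  · have hc : c ≠ a := by simpa using h
    have hs : shuffle [] v = [v] := by
      cases v <;> simp [shuffle]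
    simp [regLeft, hc, hs]

omit [Field K] [Infinite K] in
theorem regRight_of_ne {b : K} {w : List K} (h : w.getLast? ≠ some b) (h0 : w ≠ []) :
    regRight b w = Finsupp.single w 1 := by
  rw [regRight, regLeft_of_ne (by simpa using h) (by simpa using h0), Finsupp.mapDomain_single,
    List.reverse_reverse]

omit [Field K] [Infinite K] in
theorem regShuffle_of_conv {n : ℕ} {a b : K} {w : List K} (h : IsConvergent n a w b)
    (h0 : w ≠ []) : regShuffle n a w b = symb n a w b := by
  rw [regShuffle, regLeft_of_ne h.2.1 h0, Finsupp.sum_single_index (by simp),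
    regRight_of_ne h.2.2 h0, Finsupp.sum_single_index (by simp), mul_one, one_smul]

/-- The decomposition of a weight two hyperlogarithm, valid for the regularized symbols too. -/
theorem cls_two (a x y b : K) :
    cls (relations 2 K) a [x, y] b = dilog a x y - dilog x y b := by
  have e0 : ∀ w, cls (relations 2 K) a w b = (relations 2 K).mkQ (regShuffle 2 a w b) :=
    fun w => by rw [cls, reg_two]
  rw [e0]
  by_cases hax : x = a
  · subst hax
    rw [dilog_eq_zero (Or.inl rfl), zero_sub]
    by_cases hxy : y = x
    · subst hxy
      rw [dilog_eq_zero (Or.inl rfl)]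
      simp [regShuffle, regLeft]
    · have h1 : regLeft x [x, y] = -Finsupp.single [y, x] 1 := by
        simp [regLeft, hxy, shuffle]
      rw [regShuffle, h1, ← Finsupp.single_neg, Finsupp.sum_single_index (by simp)]
      by_cases hxb : x = b
      · subst hxb
        rw [dilog_outer, neg_zero]
        have h2 : regRight x [y, x] = -Finsupp.single [x, y] 1 := by
          simp [regRight, regLeft, hxy, shuffle, ← Finsupp.single_neg, Finsupp.mapDomain_single]
        rw [h2, ← Finsupp.single_neg, Finsupp.sum_single_index (by simp)]
        rw [symb_of_not_conv (by simp [conv_two]), smul_zero, map_zero]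
      · rw [regRight_of_ne (by simpa using hxb) (by simp), Finsupp.sum_single_index (by simp),
          map_smul]
        rw [dilog_swap_left y x b, dilog]
        simp [hyp]
  · by_cases hyb : y = b
    · subst hyb
      rw [dilog_eq_zero (Or.inr rfl), sub_zero, regShuffle, regLeft_of_ne (by simpa using hax)
        (by simp), Finsupp.sum_single_index (by simp)]
      by_cases hxy : x = y
      · subst hxy
        rw [dilog_eq_zero (Or.inr rfl)]
        simp [regRight, regLeft]
      · have h2 : regRight y [x, y] = -Finsupp.single [y, x] 1 := by
          simp [regRight, regLeft, hxy, shuffle, ← Finsupp.single_neg, Finsupp.mapDomain_single]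
        rw [h2, ← Finsupp.single_neg, Finsupp.sum_single_index (by simp), map_smul]
        by_cases hay : a = y
        · subst hay
          rw [dilog_outer, symb_of_not_conv (by simp [conv_two]), map_zero, smul_zero]
        · have h3 := hyp_two_eq hay (Ne.symm hxy) hxy
          rw [dilog_outer, sub_zero, dilog_swap_right] at h3
          rw [hyp] at h3
          rw [h3]
          simp
    · rw [regShuffle_of_conv (conv_two.2 ⟨Ne.symm hax, hyb⟩) (by simp)]
      by_cases hxy : x = y
      · subst hxy
        rw [dilog_eq_zero (Or.inr rfl), dilog_eq_zero (Or.inl rfl), sub_zero]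
        exact hyp_two_repeat (Ne.symm hax) hyb
      · exact hyp_two_eq (Ne.symm hax) hxy hyb

end WeightTwo

/-! ### Points, charts and cross-ratios -/

section Charts

variable {K : Type u} [Field K]

/-- Homogeneous coordinates of the points `p 0, …, p 5` and of `∞`, which has the index `6`. -/
def pt (p : ℕ → K) (i : ℕ) : K × K := if i = 6 then (1, 0) else (p i, 1)

/-- The determinant of two points; for finite points it is their difference. -/
def det (p : ℕ → K) (i j : ℕ) : K := (pt p i).1 * (pt p j).2 - (pt p j).1 * (pt p i).2

/-- The affine coordinates in use: the given one, and, for three points `U, V, W`, the one that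
takes the values `∞, 0, 1` there. -/
inductive Chart
  | affine
  | proj (U V W : ℕ)
  deriving DecidableEq

/-- The coordinate of the point with index `i` in a chart. -/
def coord (p : ℕ → K) : Chart × ℕ → K
  | (Chart.affine, i) => p i
  | (Chart.proj U V W, i) => det p U W * det p V i / (det p U i * det p V W)

/-- The points with indices in `S` are distinct. -/
def Generic (p : ℕ → K) (S : List ℕ) : Prop := ∀ i ∈ S, ∀ j ∈ S, i ≠ j → det p i j ≠ 0

/-- A hyperlogarithm symbol whose letters are indices of points, read in a chart. -/
abbrev CSymb := Chart × FSymb ℕ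

/-- The symbol of coordinates. -/
def CSymb.toF (t : CSymb) : FSymb (Chart × ℕ) :=
  ((t.1, t.2.1), t.2.2.1.map fun i => (t.1, i), (t.1, t.2.2.2))

/-- The chart is given by distinct points with indices in `S`. -/
def Chart.Ok (S : List ℕ) : Chart → Prop
  | Chart.affine => True
  | Chart.proj U V W => U ∈ S ∧ V ∈ S ∧ W ∈ S ∧ U ≠ V ∧ V ≠ W ∧ U ≠ W

/-- The point with index `i` is in `S` and has a finite coordinate. -/
def Chart.Fin (S : List ℕ) (i : ℕ) : Chart → Prop
  | Chart.affine => i ∈ S ∧ i ≠ 6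
  | Chart.proj U _ _ => i ∈ S ∧ i ≠ U

instance (S : List ℕ) (c : Chart) : Decidable (c.Ok S) := by
  cases c <;> unfold Chart.Ok <;> infer_instance

instance (S : List ℕ) (i : ℕ) (c : Chart) : Decidable (c.Fin S i) := by
  cases c <;> unfold Chart.Fin <;> infer_instance

theorem det_self (p : ℕ → K) (i : ℕ) : det p i i = 0 := by unfold det; ring

theorem det_swap (p : ℕ → K) (i j : ℕ) : det p j i = -det p i j := by unfold det; ring

theorem lg_det_swap (p : ℕ → K) (i j : ℕ) : lg (det p j i) = lg (det p i j) := by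
  rw [det_swap, lg_neg]

theorem det_fin (p : ℕ → K) {i j : ℕ} (hi : i ≠ 6) (hj : j ≠ 6) : det p i j = p i - p j := by
  simp [det, pt, hi, hj]

theorem det_inf_left (p : ℕ → K) {j : ℕ} (hj : j ≠ 6) : det p 6 j = 1 := by
  simp [det, pt, hj]

theorem det_inf_right (p : ℕ → K) {j : ℕ} (hj : j ≠ 6) : det p j 6 = -1 := by
  simp [det, pt, hj]

theorem det_plucker (p : ℕ → K) (U V i j : ℕ) :
    det p V i * det p U j - det p V j * det p U i = -(det p U V * det p i j) := by
  unfold det; ring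

theorem coord_sub (p : ℕ → K) {U V W i j : ℕ} (hi : det p U i ≠ 0) (hj : det p U j ≠ 0) :
    coord p (Chart.proj U V W, i) - coord p (Chart.proj U V W, j) =
      -((det p U W / det p V W) * (det p U V * det p i j)) / (det p U i * det p U j) := by
  have h := det_plucker p U V i j
  by_cases hVW : det p V W = 0
  · simp [coord, hVW]
  simp only [coord]
  field_simp
  linear_combination det p U W * h

theorem coord_injOn {p : ℕ → K} {S : List ℕ} (hp : Generic p S) {c : Chart} (hc : c.Ok S)
    {i j : ℕ} (hi : c.Fin S i) (hj : c.Fin S j) (hij : i ≠ j) : coord p (c, i) ≠ coord p (c, j) := by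
  cases c with
  | affine =>
    have := hp i hi.1 j hj.1 hij
    rw [det_fin p hi.2 hj.2] at this
    exact sub_ne_zero.1 this
  | proj U V W =>
    obtain ⟨hU, hV, hW, hUV, hVW, hUW⟩ := hc
    rw [← sub_ne_zero, coord_sub p (hp U hU i hi.1 (Ne.symm hi.2)) (hp U hU j hj.1 (Ne.symm hj.2))]
    refine div_ne_zero (neg_ne_zero.2 (mul_ne_zero (div_ne_zero ?_ ?_) (mul_ne_zero ?_ ?_)))
      (mul_ne_zero ?_ ?_)
    exacts [hp _ hU _ hW hUW, hp _ hV _ hW hVW, hp _ hU _ hV hUV, hp _ hi.1 _ hj.1 hij,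
      hp _ hU _ hi.1 (Ne.symm hi.2), hp _ hU _ hj.1 (Ne.symm hj.2)]

/-- A symbol of weight `n` is convergent and its letters are finite in its chart, which
is nondegenerate; the indices are taken from `S`. -/
def CSymb.Ok (n : ℕ) (S : List ℕ) (t : CSymb) : Prop :=
  t.1.Ok S ∧ (∀ i ∈ letters t.2, t.1.Fin S i) ∧ t.2.2.1.length = n ∧
    t.2.2.1.head? ≠ some t.2.1 ∧ t.2.2.1.getLast? ≠ some t.2.2.2

instance (n : ℕ) (S : List ℕ) (t : CSymb) : Decidable (t.Ok n S) := by
  unfold CSymb.Ok; infer_instance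

theorem CSymb.Ok.conv {n : ℕ} {S : List ℕ} {t : CSymb} (ht : t.Ok n S) {p : ℕ → K}
    (hp : Generic p S) : ConvAt n (coord p) t.toF := by
  obtain ⟨c, a, w, b⟩ := t
  obtain ⟨h1, h2, h3, h4, h5⟩ := ht
  simp only at h1 h2 h3 h4 h5
  have ha := h2 a (by simp [letters])
  have hb := h2 b (by simp [letters])
  have hw : ∀ i ∈ w, c.Fin S i := fun i hi => h2 i (by simp [letters, hi])
  refine ⟨by simpa [CSymb.toF] using h3, ?_, ?_⟩
  · cases hh : w.head? with
    | none => simp [CSymb.toF, hh]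
    | some x =>
      have hx := hw x (List.mem_of_mem_head? hh)
      rw [hh] at h4
      simpa [CSymb.toF, hh] using coord_injOn hp h1 hx ha fun h => h4 (by rw [h])
  · cases hh : w.getLast? with
    | none => simp [CSymb.toF, hh]
    | some x =>
      have hx := hw x (List.mem_of_mem_getLast? hh)
      rw [hh] at h5
      simpa [CSymb.toF, hh] using coord_injOn hp h1 hx hb fun h => h5 (by rw [h])

theorem spec_det {c : K} {X : ℕ → RatFunc K} {x : ℕ → K} (h : ∀ i, Spec c (X i) (x i)) (i j : ℕ) :
    Spec c (det X i j) (det x i j) := by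
  have h1 : ∀ i, Spec c (pt X i).1 (pt x i).1 ∧ Spec c (pt X i).2 (pt x i).2 := by
    intro i
    by_cases hi : i = 6
    · simp only [pt, hi, if_true]; exact ⟨Spec.one c, Spec.zero c⟩
    · simp only [pt, hi, if_false]; exact ⟨h i, Spec.one c⟩
  exact ((h1 i).1.mul (h1 j).2).sub ((h1 j).1.mul (h1 i).2)

theorem Generic.of_spec {c : K} {X : ℕ → RatFunc K} {x : ℕ → K} (h : ∀ i, Spec c (X i) (x i))
    {S : List ℕ} (hx : Generic x S) : Generic X S := fun i hi j hj hij =>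
  (spec_det h i j).ne_zero (hx i hi j hj hij)

/-! ### Formal logarithms and dilogarithms -/

/-- The formal logarithm of the determinant of two points. -/
def pairL (i j : ℕ) : List (ℤ × (ℕ × ℕ)) :=
  if i = 6 ∨ j = 6 ∨ i = j then [] else if i < j then [(1, (i, j))] else [(1, (j, i))]

/-- The formal logarithm of the difference of two coordinates. -/
def logL (c : Chart) (i j : ℕ) : List (ℤ × (ℕ × ℕ)) :=
  if i = j then [] else match c with
  | Chart.affine => pairL i j
  | Chart.proj U V W => pairL i j ++ scale (-1) (pairL i U ++ pairL j U ++ pairL V W) ++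
      (pairL U V ++ pairL U W)

/-- The value of a formal logarithm. -/
noncomputable def lgAt (p : ℕ → K) (π : ℕ × ℕ) : H 1 K := lg (p π.1 - p π.2)

theorem lsum_pairL (p : ℕ → K) (i j : ℕ) : lsum (pairL i j) (lgAt p) = lg (det p i j) := by
  unfold pairL
  by_cases hi : i = 6
  · subst hi
    by_cases hj : j = 6
    · subst hj; simp [det_self]
    · simp [det_inf_left p hj]
  by_cases hj : j = 6
  · subst hj; simp [det_inf_right p hi]
  by_cases hij : i = j
  · subst hij; simp [det_self]
  rw [det_fin p hi hj]
  simp only [hi, hj, hij, or_self, if_false]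
  split_ifs
  · simp [lgAt]
  · simp [lgAt, lg_sub_comm (p j)]

theorem lsum_logL {p : ℕ → K} {S : List ℕ} (hp : Generic p S) {c : Chart} (hc : c.Ok S)
    {i j : ℕ} (hi : c.Fin S i) (hj : c.Fin S j) :
    lsum (logL c i j) (lgAt p) = lg (coord p (c, i) - coord p (c, j)) := by
  unfold logL
  by_cases hij : i = j
  · simp [hij]
  rw [if_neg hij]
  cases c with
  | affine => rw [lsum_pairL, det_fin p hi.2 hj.2]; rfl
  | proj U V W =>
    obtain ⟨hU, hV, hW, hUV, hVW, hUW⟩ := hc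
    have hUi := hp U hU i hi.1 (Ne.symm hi.2)
    have hUj := hp U hU j hj.1 (Ne.symm hj.2)
    have h1 := hp U hU W hW hUW
    have h2 := hp V hV W hW hVW
    have h3 := hp U hU V hV hUV
    have h4 := hp i hi.1 j hj.1 hij
    have h5 := div_ne_zero h1 h2
    rw [coord_sub p hUi hUj, neg_div, lg_neg, lg_div (mul_ne_zero h5 (mul_ne_zero h3 h4))
      (mul_ne_zero hUi hUj), lg_mul h5 (mul_ne_zero h3 h4), lg_mul h3 h4, lg_mul hUi hUj,
      lg_div h1 h2]
    simp only [lsum_append, lsum_scale, lsum_pairL]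
    rw [lg_det_swap p U i, lg_det_swap p U j]
    module

/-- The formal dilogarithm of three points, as `±1` times a symbol with increasing indices; it is
zero if a point is `∞` or two of them agree. -/
def tripL (i j k : ℕ) : List (ℤ × (ℕ × ℕ × ℕ)) :=
  if i = 6 ∨ j = 6 ∨ k = 6 ∨ i = j ∨ j = k ∨ i = k then []
  else if i < j then
    (if j < k then [(1, (i, j, k))] else if i < k then [(-1, (i, k, j))] else [(1, (k, i, j))])
  else
    (if i < k then [(-1, (j, i, k))] else if j < k then [(1, (j, k, i))] else [(-1, (k, j, i))])

/-- The formal dilogarithm of three coordinates, by the five-term relation. -/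
def dilogL (c : Chart) (i j k : ℕ) : List (ℤ × (ℕ × ℕ × ℕ)) :=
  match c with
  | Chart.affine => tripL i j k
  | Chart.proj U _ _ => tripL i j k ++ scale (-1) (tripL i j U) ++
      (tripL i k U ++ scale (-1) (tripL j k U))

/-- The value of a formal dilogarithm. -/
noncomputable def dilogAt (p : ℕ → K) (τ : ℕ × ℕ × ℕ) : H 2 K := dilog (p τ.1) (p τ.2.1) (p τ.2.2)

variable [Infinite K]

/-- The dilogarithm of three points, which vanishes if one of them is `∞`. -/
noncomputable def dilogPt (p : ℕ → K) (i j k : ℕ) : H 2 K :=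
  if i = 6 ∨ j = 6 ∨ k = 6 then 0 else dilog (p i) (p j) (p k)

omit [Infinite K] in
theorem dilogPt_fin (p : ℕ → K) {i j k : ℕ} (hi : i ≠ 6) (hj : j ≠ 6) (hk : k ≠ 6) :
    dilogPt p i j k = dilog (p i) (p j) (p k) := by simp [dilogPt, hi, hj, hk]

theorem lsum_tripL (p : ℕ → K) (i j k : ℕ) :
    lsum (tripL i j k) (dilogAt p) = dilogPt p i j k := by
  unfold tripL
  by_cases h6 : i = 6 ∨ j = 6 ∨ k = 6
  · rw [if_pos (by tauto), dilogPt, if_pos h6]; rfl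
  obtain ⟨hi, hj, hk⟩ : i ≠ 6 ∧ j ≠ 6 ∧ k ≠ 6 := by tauto
  rw [dilogPt_fin p hi hj hk]
  by_cases hij : i = j
  · subst hij; simp [dilog_eq_zero]
  by_cases hjk : j = k
  · subst hjk; simp [dilog_eq_zero]
  by_cases hik : i = k
  · subst hik; simp [dilog_outer]
  rw [if_neg (by tauto)]
  split_ifs <;> simp only [lsum_cons, lsum_nil, dilogAt, add_zero, one_smul, neg_smul]
  · rw [dilog_swap_right (p i) (p j) (p k), neg_neg]
  · rw [dilog_rotate]
  · rw [dilog_swap_left (p i) (p j) (p k), neg_neg]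
  · rw [← dilog_rotate]
  · rw [dilog_swap (p i) (p j) (p k), neg_neg]

omit [Infinite K] in
/-- Up to an affine map, the coordinate of a chart with `U` at infinity is `1 / (x - U)`, or `x`
itself if `U = ∞`. -/
theorem coord_eq_affine (p : ℕ → K) {U V W : ℕ} (hUV : U ≠ V)
    (h1 : det p U W ≠ 0) (h2 : det p V W ≠ 0) (h3 : det p U V ≠ 0) :
    ∃ l m : K, l ≠ 0 ∧ ∀ i, i ≠ U → det p U i ≠ 0 → coord p (Chart.proj U V W, i) =
      m + l * (if U = 6 then p i else if i = 6 then 0 else (p i - p U)⁻¹) := by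
  have h4 := div_ne_zero h1 h2
  by_cases hU : U = 6
  · subst hU
    have hV : V ≠ 6 := hUV.symm
    refine ⟨-(det p 6 W / det p V W), det p 6 W / det p V W * p V, neg_ne_zero.2 h4,
      fun i hi _ => ?_⟩
    rw [coord, det_inf_left p hi, det_fin p hV hi]
    simp only [if_true]
    field_simp
    ring
  by_cases hV : V = 6
  · subst hV
    refine ⟨-(det p U W / det p 6 W), 0, neg_ne_zero.2 h4, fun i hi hd => ?_⟩
    rw [coord]
    by_cases h6 : i = 6
    · subst h6; simp [det_self, hU]
    · rw [det_fin p hU h6] at hd ⊢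
      have hd' : p i - p U ≠ 0 := by rw [← neg_sub]; exact neg_ne_zero.2 hd
      rw [det_inf_left p h6]
      simp only [hU, h6, if_false]
      field_simp
      ring
  · rw [det_fin p hU hV] at h3
    refine ⟨(det p U W / det p V W) * (p U - p V), det p U W / det p V W, mul_ne_zero h4 h3,
      fun i hi hd => ?_⟩
    rw [coord]
    by_cases h6 : i = 6
    · subst h6; simp [det_inf_right p hU, det_inf_right p hV, hU]
    · rw [det_fin p hU h6] at hd ⊢
      have hd' : p i - p U ≠ 0 := by rw [← neg_sub]; exact neg_ne_zero.2 hd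
      rw [det_fin p hV h6]
      simp only [hU, h6, if_false]
      field_simp
      ring

/-- The five-term relation for four points of the projective line and `∞`. -/
theorem dilog_coord {p : ℕ → K} {S : List ℕ} (hp : Generic p S) {U V W : ℕ}
    (hc : (Chart.proj U V W).Ok S) {i j k : ℕ} (hi : (Chart.proj U V W).Fin S i)
    (hj : (Chart.proj U V W).Fin S j) (hk : (Chart.proj U V W).Fin S k) :
    dilog (coord p (Chart.proj U V W, i)) (coord p (Chart.proj U V W, j))
        (coord p (Chart.proj U V W, k)) =
      dilogPt p i j k - dilogPt p i j U + dilogPt p i k U - dilogPt p j k U := by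
  obtain ⟨hU, hV, hW, hUV, hVW, hUW⟩ := hc
  obtain ⟨l, m, hl, h⟩ := coord_eq_affine p hUV (hp _ hU _ hW hUW) (hp _ hV _ hW hVW)
    (hp _ hU _ hV hUV)
  have hd : ∀ {i}, (Chart.proj U V W).Fin S i → det p U i ≠ 0 := fun hi =>
    hp _ hU _ hi.1 (Ne.symm hi.2)
  rw [h i hi.2 (hd hi), h j hj.2 (hd hj), h k hk.2 (hd hk), dilog_affine hl]
  by_cases h6 : U = 6
  · subst h6
    simp only [if_true]
    rw [dilogPt_fin p hi.2 hj.2 hk.2]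
    simp [dilogPt]
  simp only [h6, if_false]
  have hne : ∀ {i}, (Chart.proj U V W).Fin S i → i ≠ 6 → p i ≠ p U := by
    intro i hi h
    have := hd hi
    rw [det_fin p h6 h] at this
    exact (sub_ne_zero.1 this).symm
  have h0 : ∀ i j k, (i = 6 ∨ j = 6 ∨ k = 6) → dilogPt p i j k = 0 := fun i j k h => if_pos h
  by_cases hi6 : i = 6
  · by_cases hj6 : j = 6
    · simp [hi6, hj6, h0, dilog_eq_zero]
    by_cases hk6 : k = 6
    · simp [hi6, hk6, h0, dilog_outer]
    simp only [hi6, hj6, hk6, if_true, if_false]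
    rw [dilog_zero_inv (hne hj hj6) (hne hk hk6), dilogPt_fin p hj6 hk6 h6]
    simp [h0]
  by_cases hj6 : j = 6
  · by_cases hk6 : k = 6
    · simp [hj6, hk6, h0, dilog_eq_zero]
    simp only [hi6, hj6, hk6, if_true, if_false]
    rw [dilog_swap_left, dilog_zero_inv (hne hi hi6) (hne hk hk6), dilogPt_fin p hi6 hk6 h6]
    simp [h0]
  by_cases hk6 : k = 6
  · simp only [hi6, hj6, hk6, if_true, if_false]
    rw [← dilog_rotate, dilog_zero_inv (hne hi hi6) (hne hj hj6), dilogPt_fin p hi6 hj6 h6]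
    simp [h0]
  simp only [hi6, hj6, hk6, if_false]
  rw [dilog_inv (hne hi hi6) (hne hj hj6) (hne hk hk6), dilogPt_fin p hi6 hj6 hk6,
    dilogPt_fin p hi6 hj6 h6, dilogPt_fin p hi6 hk6 h6, dilogPt_fin p hj6 hk6 h6]

theorem lsum_dilogL {p : ℕ → K} {S : List ℕ} (hp : Generic p S) {c : Chart} (hc : c.Ok S)
    {i j k : ℕ} (hi : c.Fin S i) (hj : c.Fin S j) (hk : c.Fin S k) :
    lsum (dilogL c i j k) (dilogAt p) =
      dilog (coord p (c, i)) (coord p (c, j)) (coord p (c, k)) := by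
  cases c with
  | affine =>
    change lsum (tripL i j k) (dilogAt p) = dilog (p i) (p j) (p k)
    rw [lsum_tripL, dilogPt_fin p hi.2 hj.2 hk.2]
  | proj U V W =>
    rw [dilog_coord hp hc hi hj hk]
    simp only [dilogL, lsum_append, lsum_scale, lsum_tripL]
    module

end Charts

/-! ### Formal tensors -/

section Tensors

variable {α β : Type*} {M N : Type*} [AddCommGroup M] [Module ℚ M] [AddCommGroup N] [Module ℚ N]

/-- A formal tensor, that is, a sum of products of formal combinations. -/
abbrev FTensor (α β : Type*) := List (List (ℤ × α) × List (ℤ × β))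

/-- The value of a formal tensor under a bilinear map. -/
def FTensor.eval {P : Type*} [AddCommGroup P] [Module ℚ P] (Φ : M →ₗ[ℚ] N →ₗ[ℚ] P) (f : α → M)
    (g : β → N) (Q : FTensor α β) : P := (Q.map fun q => Φ (lsum q.1 f) (lsum q.2 g)).sum

/-- Multiplication of a formal tensor by an integer. -/
def FTensor.smul (c : ℤ) (Q : FTensor α β) : FTensor α β := Q.map fun q => (scale c q.1, q.2)

/-- The coefficient of a symbol in a combination. -/
def coefAt [DecidableEq β] (π : β) : List (ℤ × β) → ℤ
  | [] => 0
  | t :: L => if t.2 = π then t.1 + coefAt π L else coefAt π L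

/-- The combination that is paired with the symbol `π` in a formal tensor. -/
def FTensor.extract [DecidableEq β] (π : β) (Q : FTensor α β) : List (ℤ × α) :=
  Q.flatMap fun q => if coefAt π q.2 = 0 then [] else scale (coefAt π q.2) q.1

/-- All symbols of the second factors are in `T`. -/
def FTensor.KeysIn (T : List β) (Q : FTensor α β) : Prop := ∀ q ∈ Q, ∀ t ∈ q.2, t.2 ∈ T

instance [DecidableEq β] (T : List β) (Q : FTensor α β) : Decidable (Q.KeysIn T) := by
  unfold FTensor.KeysIn; infer_instance

variable {P : Type*} [AddCommGroup P] [Module ℚ P] (Φ : M →ₗ[ℚ] N →ₗ[ℚ] P) (f : α → M) (g : β → N)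

@[simp] theorem FTensor.eval_nil : FTensor.eval Φ f g [] = 0 := rfl

@[simp] theorem FTensor.eval_cons (q : List (ℤ × α) × List (ℤ × β)) (Q : FTensor α β) :
    FTensor.eval Φ f g (q :: Q) = Φ (lsum q.1 f) (lsum q.2 g) + FTensor.eval Φ f g Q := by
  simp [FTensor.eval]

@[simp] theorem FTensor.eval_append (Q Q' : FTensor α β) :
    FTensor.eval Φ f g (Q ++ Q') = FTensor.eval Φ f g Q + FTensor.eval Φ f g Q' := by
  simp [FTensor.eval]

@[simp] theorem FTensor.eval_smul (c : ℤ) (Q : FTensor α β) :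
    FTensor.eval Φ f g (Q.smul c) = c • FTensor.eval Φ f g Q := by
  induction Q with
  | nil => simp [FTensor.smul]
  | cons q Q ih =>
    have : FTensor.smul c (q :: Q) = (scale c q.1, q.2) :: FTensor.smul c Q := rfl
    rw [this, FTensor.eval_cons, FTensor.eval_cons, ih, lsum_scale, map_zsmul,
      LinearMap.smul_apply, smul_add]

omit [Module ℚ N] in
theorem lsum_eq_sum_coefAt [DecidableEq β] (T : Finset β) (L : List (ℤ × β))
    (h : ∀ t ∈ L, t.2 ∈ T) : lsum L g = ∑ π ∈ T, coefAt π L • g π := by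
  induction L with
  | nil => simp [coefAt]
  | cons t L ih =>
    have : ∀ π, coefAt π (t :: L) • g π = (if t.2 = π then t.1 • g π else 0) + coefAt π L • g π := by
      intro π
      rw [coefAt]
      split_ifs
      · rw [add_smul]
      · rw [zero_add]
    simp_rw [this]
    rw [Finset.sum_add_distrib, ← ih fun s hs => h s (by simp [hs]), Finset.sum_ite_eq,
      if_pos (h t (by simp)), lsum_cons]

/-- The value of a formal tensor, sorted by the symbols of the second factors. -/
theorem FTensor.eval_eq_sum_extract [DecidableEq β] (T : List β) (Q : FTensor α β)
    (h : Q.KeysIn T) :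
    FTensor.eval Φ f g Q = ∑ π ∈ T.toFinset, Φ (lsum (Q.extract π) f) (g π) := by
  induction Q with
  | nil => simp [FTensor.extract]
  | cons q Q ih =>
    have h1 : ∀ π, lsum (FTensor.extract π (q :: Q)) f =
        coefAt π q.2 • lsum q.1 f + lsum (FTensor.extract π Q) f := by
      intro π
      have : FTensor.extract π (q :: Q) = (if coefAt π q.2 = 0 then [] else
        scale (coefAt π q.2) q.1) ++ FTensor.extract π Q := rfl
      rw [this, lsum_append]
      split_ifs with h0
      · simp [h0]
      · rw [lsum_scale]
    simp_rw [h1]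
    rw [FTensor.eval_cons, ih fun q' hq' => h q' (by simp [hq']),
      lsum_eq_sum_coefAt g T.toFinset q.2 fun t ht => by simpa using h q (by simp) t ht]
    simp only [map_add, LinearMap.add_apply, Finset.sum_add_distrib, map_sum, map_zsmul,
      LinearMap.smul_apply]

/-- A formal tensor has the value zero if every symbol of the second factor is paired with zero. -/
theorem FTensor.eval_eq_zero [DecidableEq β] (T : List β) (Q : FTensor α β)
    (h : Q.KeysIn T) (h0 : ∀ π ∈ T, lsum (Q.extract π) f = 0) : FTensor.eval Φ f g Q = 0 := by
  rw [FTensor.eval_eq_sum_extract Φ f g T Q h]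
  refine Finset.sum_eq_zero fun π hπ => ?_
  rw [h0 π (by simpa using hπ), map_zero, LinearMap.zero_apply]

/-- Linear extension of a map from symbols to formal tensors. -/
def FTensor.bind {γ : Type*} (L : List (ℤ × γ)) (φ : γ → FTensor α β) : FTensor α β :=
  L.flatMap fun t => (φ t.2).smul t.1

theorem FTensor.eval_bind {γ : Type*} (L : List (ℤ × γ)) (φ : γ → FTensor α β) :
    FTensor.eval Φ f g (FTensor.bind L φ) = lsum L fun s => FTensor.eval Φ f g (φ s) := by
  induction L with
  | nil => rfl
  | cons t L ih =>
    have : FTensor.bind (t :: L) φ = (φ t.2).smul t.1 ++ FTensor.bind L φ := rfl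
    rw [this, FTensor.eval_append, FTensor.eval_smul, ih, lsum_cons]

end Tensors

/-! ### Weight three -/

section WeightThree

/-- The formal class of `[a | x | b]` in weight one. -/
def h1L (c : Chart) (a x b : ℕ) : List (ℤ × (ℕ × ℕ)) := logL c b x ++ scale (-1) (logL c a x)

/-- The formal class of `[a | x, y | b]` in weight two. -/
def h2L (c : Chart) (a x y b : ℕ) : List (ℤ × (ℕ × ℕ × ℕ)) :=
  dilogL c a x y ++ scale (-1) (dilogL c x y b)

/-- The formal cobracket of a symbol of weight three. -/
def cobracket3 : CSymb → FTensor (ℕ × ℕ × ℕ) (ℕ × ℕ)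
  | (c, a, [x, y, z], b) => [(h2L c a y z b, h1L c a x y), (h2L c a x z b, h1L c x y z),
      (h2L c a x y b, h1L c y z b), (scale (-1) (h2L c a x y z), h1L c a z b),
      (scale (-1) (h2L c x y z b), h1L c a x b)]
  | _ => []

/-- The pairs of finite points. -/
def pairs : List (ℕ × ℕ) := [(0, 1), (0, 2), (0, 3), (0, 4), (0, 5), (1, 2), (1, 3), (1, 4), (1, 5),
  (2, 3), (2, 4), (2, 5), (3, 4), (3, 5), (4, 5)]

/-- The combination of symbols of weight three has a formal cobracket that vanishes identically. -/
def Closed3 (L : List (ℤ × CSymb)) : Prop :=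
  (FTensor.bind L cobracket3).KeysIn pairs ∧
    ∀ π ∈ pairs, Cancels ((FTensor.bind L cobracket3).extract π)

instance (L : List (ℤ × CSymb)) : Decidable (Closed3 L) := by unfold Closed3; infer_instance

variable {K : Type u} [Field K]

theorem delta_symb {k l : ℕ} (n : ℕ) (R : Submodule ℚ (Symb K k →₀ ℚ))
    (R' : Submodule ℚ (Symb K l →₀ ℚ)) {a b : K} {w : List K} (h : IsConvergent n a w b) :
    delta n R R' (symb n a w b) =
      coprod R R' a w b - TensorProduct.comm ℚ _ _ (coprod R' R a w b) := by
  simp [delta, coprodLin, symb_of_conv h]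

variable [Infinite K]

theorem delta_three {a x y z b : K} (h : IsConvergent 3 a [x, y, z] b) :
    delta 3 (relations 2 K) (relations 1 K) (symb 3 a [x, y, z] b) =
      (dilog a y z - dilog y z b) ⊗ₜ[ℚ] (lg (y - x) - lg (a - x))
      + (dilog a x z - dilog x z b) ⊗ₜ[ℚ] (lg (z - y) - lg (x - y))
      + (dilog a x y - dilog x y b) ⊗ₜ[ℚ] (lg (b - z) - lg (y - z))
      - (dilog a x y - dilog x y z) ⊗ₜ[ℚ] (lg (b - z) - lg (a - z))
      - (dilog x y z - dilog y z b) ⊗ₜ[ℚ] (lg (b - x) - lg (a - x)) := by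
  rw [delta_symb 3 _ _ h]
  simp [coprod, Finset.sum_range_succ, cls_one, cls_two]
  abel

omit [Infinite K] in
theorem lsum_h1L {p : ℕ → K} {S : List ℕ} (hp : Generic p S) {c : Chart} (hc : c.Ok S)
    {a x b : ℕ} (ha : c.Fin S a) (hx : c.Fin S x) (hb : c.Fin S b) :
    lsum (h1L c a x b) (lgAt p) =
      lg (coord p (c, b) - coord p (c, x)) - lg (coord p (c, a) - coord p (c, x)) := by
  rw [h1L, lsum_append, lsum_scale, lsum_logL hp hc hb hx, lsum_logL hp hc ha hx]
  module

theorem lsum_h2L {p : ℕ → K} {S : List ℕ} (hp : Generic p S) {c : Chart} (hc : c.Ok S)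
    {a x y b : ℕ} (ha : c.Fin S a) (hx : c.Fin S x) (hy : c.Fin S y) (hb : c.Fin S b) :
    lsum (h2L c a x y b) (dilogAt p) =
      dilog (coord p (c, a)) (coord p (c, x)) (coord p (c, y))
        - dilog (coord p (c, x)) (coord p (c, y)) (coord p (c, b)) := by
  rw [h2L, lsum_append, lsum_scale, lsum_dilogL hp hc ha hx hy, lsum_dilogL hp hc hx hy hb]
  module

theorem delta_three_formal {p : ℕ → K} {S : List ℕ} (hp : Generic p S) {t : CSymb}
    (ht : t.Ok 3 S) :
    delta 3 (relations 2 K) (relations 1 K) (symbAt 3 (coord p) t.toF) =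
      (cobracket3 t).eval (TensorProduct.mk ℚ (H 2 K) (H 1 K)) (dilogAt p) (lgAt p) := by
  have hconv := ht.conv hp
  obtain ⟨c, a, w, b⟩ := t
  obtain ⟨hc, hl, hlen, -, -⟩ := ht
  obtain ⟨x, y, z, rfl⟩ : ∃ x y z, w = [x, y, z] := List.length_eq_three.1 hlen
  have ha := hl a (by simp [letters])
  have hb := hl b (by simp [letters])
  have hx := hl x (by simp [letters])
  have hy := hl y (by simp [letters])
  have hz := hl z (by simp [letters])
  simp only at hc ha hb hx hy hz
  refine (delta_three hconv).trans ?_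
  simp only [cobracket3, FTensor.eval_cons, FTensor.eval_nil, lsum_scale, TensorProduct.mk_apply,
    lsum_h1L hp hc ha hx hy, lsum_h1L hp hc hx hy hz, lsum_h1L hp hc hy hz hb,
    lsum_h1L hp hc ha hz hb, lsum_h1L hp hc ha hx hb, lsum_h2L hp hc ha hy hz hb,
    lsum_h2L hp hc ha hx hz hb, lsum_h2L hp hc ha hx hy hb, lsum_h2L hp hc ha hx hy hz,
    lsum_h2L hp hc hx hy hz hb, neg_smul, one_smul, TensorProduct.neg_tmul]
  abel

/-- The value in `H_n` of a symbol of points. -/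
noncomputable def hypC (n : ℕ) (p : ℕ → K) (t : CSymb) : H n K := hypAt n (coord p) t.toF

/-- Substitution of indices in a chart. -/
def Chart.relabel (σ : ℕ → ℕ) : Chart → Chart
  | .affine => .affine
  | .proj U V W => .proj (σ U) (σ V) (σ W)

/-- Substitution of indices in a symbol. -/
def CSymb.relabel (σ : ℕ → ℕ) (t : CSymb) : CSymb :=
  (t.1.relabel σ, σ t.2.1, t.2.2.1.map σ, σ t.2.2.2)

/-- Substitution of indices in a combination. -/
def relabelL (σ : ℕ → ℕ) (L : List (ℤ × CSymb)) : List (ℤ × CSymb) :=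
  L.map fun t => (t.1, t.2.relabel σ)

omit [Infinite K] in
theorem det_comp (p : ℕ → K) {σ : ℕ → ℕ} (hσ : ∀ i, σ i = 6 ↔ i = 6) (i j : ℕ) :
    det (p ∘ σ) i j = det p (σ i) (σ j) := by
  have : ∀ i, pt (p ∘ σ) i = pt p (σ i) := fun i => by simp [pt, hσ]
  simp only [det, this]

omit [Infinite K] in
theorem coord_comp (p : ℕ → K) {σ : ℕ → ℕ} (hσ : ∀ i, σ i = 6 ↔ i = 6) (c : Chart) (i : ℕ) :
    coord (p ∘ σ) (c, i) = coord p (c.relabel σ, σ i) := by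
  cases c with
  | affine => rfl
  | proj U V W => simp only [coord, Chart.relabel, det_comp p hσ]

omit [Infinite K] in
/-- Functions of the coordinates of a symbol do not distinguish between a substitution of the points
and a substitution of the indices. -/
theorem toF_comp {M : Type*} (p : ℕ → K) {σ : ℕ → ℕ} (hσ : ∀ i, σ i = 6 ↔ i = 6) (t : CSymb)
    (v : K → List K → K → M) :
    v (coord (p ∘ σ) t.toF.1) (t.toF.2.1.map (coord (p ∘ σ))) (coord (p ∘ σ) t.toF.2.2) =
      v (coord p (t.relabel σ).toF.1) ((t.relabel σ).toF.2.1.map (coord p))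
        (coord p (t.relabel σ).toF.2.2) := by
  have : coord (p ∘ σ) ∘ (fun i => (t.1, i)) = (coord p ∘ fun i => (t.1.relabel σ, i)) ∘ σ :=
    funext fun i => coord_comp p hσ t.1 i
  simp only [CSymb.toF, CSymb.relabel, List.map_map, coord_comp p hσ, this]
  rfl

omit [Infinite K] in
theorem hypC_comp (n : ℕ) (p : ℕ → K) {σ : ℕ → ℕ} (hσ : ∀ i, σ i = 6 ↔ i = 6) (t : CSymb) :
    hypC n (p ∘ σ) t = hypC n p (t.relabel σ) :=
  toF_comp p hσ t (hyp n)

omit [Infinite K] in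
theorem lsum_relabelL {M : Type*} [AddCommGroup M] (σ : ℕ → ℕ) (L : List (ℤ × CSymb))
    (v : CSymb → M) : lsum (relabelL σ L) v = lsum L fun t => v (t.relabel σ) := by
  simp [relabelL, lsum, Function.comp_def]

omit [Infinite K] in
theorem lsum_hypC_comp (n : ℕ) (p : ℕ → K) {σ : ℕ → ℕ} (hσ : ∀ i, σ i = 6 ↔ i = 6)
    (L : List (ℤ × CSymb)) : lsum L (hypC n (p ∘ σ)) = lsum (relabelL σ L) (hypC n p) := by
  rw [lsum_relabelL]
  exact lsum_congr fun t _ => hypC_comp n p hσ t.2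

omit [Infinite K] in
theorem convAt_comp {n : ℕ} {p : ℕ → K} {S : List ℕ} (hp : Generic p S) {σ : ℕ → ℕ}
    (hσ : ∀ i, σ i = 6 ↔ i = 6) {t : CSymb} (ht : (t.relabel σ).Ok n S) :
    ConvAt n (coord (p ∘ σ)) t.toF :=
  (toF_comp p hσ t (IsConvergent n)).mpr (ht.conv hp)

omit [Infinite K] in
theorem mem_letters_toF {t : CSymb} {i : Chart × ℕ} (hi : i ∈ letters t.toF) :
    ∃ j ∈ letters t.2, i = (t.1, j) := by
  simp only [letters, CSymb.toF, List.mem_cons, List.mem_map] at hi ⊢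
  rcases hi with rfl | rfl | ⟨j, hj, rfl⟩
  exacts [⟨_, Or.inl rfl, rfl⟩, ⟨_, Or.inr (Or.inl rfl), rfl⟩, ⟨_, Or.inr (Or.inr hj), rfl⟩]

omit [Infinite K] in
theorem spec_coord_comp {c : K} {X : ℕ → RatFunc K} {p : ℕ → K} {σ : ℕ → ℕ}
    (hσ : ∀ i, σ i = 6 ↔ i = 6) (h : ∀ i, Spec c (X i) (p (σ i))) {S : List ℕ} (hp : Generic p S)
    {n : ℕ} {t : CSymb} (ht : (t.relabel σ).Ok n S) {i : Chart × ℕ} (hi : i ∈ letters t.toF) :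
    Spec c (coord X i) (coord (p ∘ σ) i) := by
  obtain ⟨j, hj, rfl⟩ := mem_letters_toF hi
  obtain ⟨ch, s⟩ := t
  have hc : (ch.relabel σ).Ok S := ht.1
  have hf : (ch.relabel σ).Fin S (σ j) := by
    refine ht.2.1 (σ j) ?_
    simp only [letters, CSymb.relabel, List.mem_cons, List.mem_map] at hj ⊢
    rcases hj with rfl | rfl | hj
    exacts [Or.inl rfl, Or.inr (Or.inl rfl), Or.inr (Or.inr ⟨j, hj, rfl⟩)]
  cases ch with
  | affine => exact h j
  | proj U V W =>
    obtain ⟨hU, hV, hW, hUV, hVW, hUW⟩ := hc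
    have h' : ∀ i, Spec c (X i) ((p ∘ σ) i) := h
    refine ((spec_det h' U W).mul (spec_det h' V j)).div ((spec_det h' U j).mul (spec_det h' V W))
      (mul_ne_zero ?_ ?_)
    · rw [det_comp p hσ]
      exact hp _ hU _ hf.1 (Ne.symm hf.2)
    · rw [det_comp p hσ]
      exact hp _ hV _ hW hVW

omit [Infinite K] in
theorem relabel_id (t : CSymb) : t.relabel id = t := by
  obtain ⟨c, a, w, b⟩ := t
  cases c <;> simp [CSymb.relabel, Chart.relabel]

omit [Infinite K] in
/-- A combination of symbols of points is unchanged if the points are moved along a path to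
`p ∘ σ`, provided that its cobracket vanishes at the generic point of the path. -/
theorem lsum_hypC_relabel {n : ℕ} {L : List (ℤ × CSymb)} {S : List ℕ} {p : ℕ → K}
    (hp : Generic p S) {σ : ℕ → ℕ} (hσ : ∀ i, σ i = 6 ↔ i = 6) (hOk : ∀ t ∈ L, t.2.Ok (n + 2) S)
    (hOk' : ∀ t ∈ L, (t.2.relabel σ).Ok (n + 2) S) (X : ℕ → RatFunc K)
    (h0 : ∀ i, Spec 0 (X i) (p i)) (h1 : ∀ i, Spec 1 (X i) (p (σ i)))
    (hδ : ∀ k : ℕ, 0 < k ∧ 2 * k < n + 2 →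
      delta (n + 2) (relations (n + 2 - k) (RatFunc K)) (relations k (RatFunc K))
        (lsum L fun t => symbAt (n + 2) (coord X) t.toF) = 0)
    (hw : ∀ k : ℕ, 2 * k = n + 2 →
      deltaWedge (n + 2) (relations k (RatFunc K))
        (lsum L fun t => symbAt (n + 2) (coord X) t.toF) = 0) :
    lsum L (hypC (n + 2) p) = lsum (relabelL σ L) (hypC (n + 2) p) := by
  let L' : List (ℤ × FSymb (Chart × ℕ)) := L.map fun t => (t.1, t.2.toF)
  have hL' : ∀ {M : Type u} [AddCommGroup M] (v : FSymb (Chart × ℕ) → M), lsum L' v =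
      lsum L fun s => v s.toF := by
    intro M _ v
    simp [L', lsum, Function.comp_def]
  have hid : ∀ i, id i = 6 ↔ i = 6 := fun _ => Iff.rfl
  have key := lsum_hypAt_eq_of_delta n L' (coord p) (coord (p ∘ σ)) (coord X) ?_ ?_ ?_ ?_
  · rw [hL', hL'] at key
    refine Eq.trans key ?_
    exact lsum_hypC_comp (n + 2) p hσ L
  · intro t ht
    obtain ⟨s, hs, rfl⟩ := List.mem_map.1 ht
    exact ⟨(hOk s hs).conv hp, convAt_comp hp hσ (hOk' s hs)⟩
  · intro t ht i hi
    obtain ⟨s, hs, rfl⟩ := List.mem_map.1 ht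
    refine ⟨?_, spec_coord_comp hσ h1 hp (hOk' s hs) hi⟩
    exact spec_coord_comp (σ := id) hid h0 hp (by rw [relabel_id]; exact hOk s hs) hi
  · intro k hk
    rw [hL']
    exact hδ k hk
  · intro k hk
    rw [hL']
    exact hw k hk

omit [Infinite K] in
/-- A combination of symbols of weight three whose formal cobracket vanishes is unchanged if the
points are moved from `p` to `p ∘ σ`. -/
theorem Closed3.lsum_relabel {L : List (ℤ × CSymb)} (hL : Closed3 L) {S : List ℕ} {p : ℕ → K}
    (hp : Generic p S) {σ : ℕ → ℕ} (hσ : ∀ i, σ i = 6 ↔ i = 6) (hOk : ∀ t ∈ L, t.2.Ok 3 S)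
    (hOk' : ∀ t ∈ L, (t.2.relabel σ).Ok 3 S) :
    lsum L (hypC 3 p) = lsum (relabelL σ L) (hypC 3 p) := by
  have h0 : ∀ i, Spec 0 (segment (p i) (p (σ i))) (p i) := fun i => spec_segment_zero _ _
  have hX := hp.of_spec h0
  refine lsum_hypC_relabel (n := 1) hp hσ hOk hOk' _ h0 (fun i => spec_segment_one _ _) ?_ ?_
  · intro k hk
    obtain rfl : k = 1 := by omega
    rw [map_lsum]
    rw [lsum_congr (w := fun t => (cobracket3 t).eval (TensorProduct.mk ℚ (H 2 (RatFunc K))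
      (H 1 (RatFunc K))) (dilogAt _) (lgAt _)) fun t ht => delta_three_formal hX (hOk t ht),
      ← FTensor.eval_bind]
    exact FTensor.eval_eq_zero _ _ _ pairs _ hL.1 fun π hπ => (hL.2 π hπ).lsum_eq_zero _
  · intro k hk
    omega

omit [Infinite K] in
/-- A combination of symbols of weight three whose formal cobracket vanishes and that is
antisymmetric under a substitution of the points is zero. -/
theorem Closed3.lsum_eq_zero {L : List (ℤ × CSymb)} (hL : Closed3 L) {S : List ℕ} {p : ℕ → K}
    (hp : Generic p S) {σ : ℕ → ℕ} (hσ : ∀ i, σ i = 6 ↔ i = 6) (hOk : ∀ t ∈ L, t.2.Ok 3 S)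
    (hOk' : ∀ t ∈ L, (t.2.relabel σ).Ok 3 S) (h : Cancels (L ++ relabelL σ L)) :
    lsum L (hypC 3 p) = 0 := by
  have h1 := h.lsum_eq_zero (hypC 3 p)
  rw [lsum_append, ← hL.lsum_relabel hp hσ hOk hOk', ← two_smul ℚ] at h1
  simpa using h1

end WeightThree

/-! ### The formal version of `f` -/

section Formal

/-- The building blocks of `f`: the symbol `[x, y]_{3,1}` at the cross-ratios `UVWX` and `UVWY`,
and twice the `4`-logarithm at the coordinate of `X` for which `Z, O, ∞` are `0, 1, ∞`. -/
inductive Block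
  | li31 (U V W X Y : ℕ)
  | li4 (Z O X : ℕ)

/-- The symbols that make up a building block. The sign in the second case is that of
`[x]_4 = -[0 | 1, 0, 0, 0 | x]`. -/
def Block.symbols : Block → List (ℤ × CSymb)
  | .li31 U V W X Y => [(1, (Chart.proj U V W, V, [X, V, V, Y], W))]
  | .li4 Z O X => [(-2, (Chart.proj 6 Z O, Z, [O, Z, Z, Z], X))]

/-- The component in `H_3 ⊗ H_1` of the cobracket of a building block. The inversion relation
is used to write `2 [x]_3` as `[x]_3 + [1/x]_3`. -/
def Block.cobracket : Block → FTensor CSymb (ℕ × ℕ)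
  | .li31 U V W X Y =>
      let c := Chart.proj U V W
      [([(1, (c, V, [X, V, Y], W))], logL c Y V ++ scale (-1) (logL c X V)),
        ([(1, (c, V, [X, V, V], W)), (-1, (c, V, [X, V, V], Y))],
          logL c W Y ++ scale (-1) (logL c Y V)),
        ([(-1, (c, X, [V, V, Y], W))], logL c W X ++ scale (-1) (logL c X V))]
  | .li4 Z O X => [([(-1, (Chart.proj 6 Z O, Z, [O, Z, Z], X)),
      (-1, (Chart.proj 6 Z X, Z, [X, Z, Z], O))], logL (Chart.proj 6 Z O) X Z)]

/-- The concatenation of the values of `h` at the cyclic permutations of the arguments. -/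
def cyclL {α : Type*} (h : ℕ → ℕ → ℕ → ℕ → ℕ → List α) (A B C D E : ℕ) : List α :=
  h A B C D E ++ (h B C D E A ++ (h C D E A B ++ (h D E A B C ++ h E A B C D)))

/-- The formal version of `g`. -/
def gL : ℕ → ℕ → ℕ → ℕ → ℕ → List (ℤ × Block) := cyclL fun A B C D E =>
  [(1, .li31 A B C D E), (-1, .li31 E D C B A), (-3, .li31 A B D C E), (3, .li31 E D B C A)]

/-- The formal version of `20 f`. The coefficients of the `4`-logarithms are `±5`, as the building
blocks contain them twice. -/
def fL (A B C D E : ℕ) : List (ℤ × Block) :=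
  gL A B C D E ++ scale (-1) (gL 6 B C D E ++ (gL A 6 C D E ++ (gL A B 6 D E ++
    (gL A B C 6 E ++ gL A B C D 6)))) ++
  (scale 5 (cyclL (fun A B C _ _ => [(1, .li4 B A C)]) A B C D E) ++
  (scale (-5) (cyclL (fun A B _ D _ => [(1, .li4 A D B)]) A B C D E) ++
  (scale 5 (cyclL (fun A B _ D _ => [(1, .li4 B D A)]) A B C D E) ++
   scale (-5) (cyclL (fun A B _ D _ => [(1, .li4 D A B)]) A B C D E))))

/-- The formal version of `20 ∑ [A | B, C, D | E] ⊗ (E - A)` (cyclic sum), where the symbol is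
made antisymmetric under reversal. -/
def psiL : ℕ → ℕ → ℕ → ℕ → ℕ → FTensor CSymb (ℕ × ℕ) := cyclL fun A B C D E =>
  [([(10, (Chart.affine, A, [B, C, D], E)), (-10, (Chart.affine, E, [D, C, B], A))], pairL E A)]

/-- The difference of the two sides of the formula for the component in `H_3 ⊗ H_1` of the
cobracket of `20 f`. -/
def defect : FTensor CSymb (ℕ × ℕ) :=
  FTensor.bind (fL 0 1 2 3 4) Block.cobracket ++ (psiL 0 1 2 3 4).smul (-1)

/-- The reflection of the pentagon `0, 1, 2, 3, 4` that exchanges `i` and `j`. -/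
def reflection (i j t : ℕ) : ℕ := if t < 5 then (i + j + 5 - t) % 5 else t

/-- The rotation of the pentagon `0, 1, 2, 3, 4` by `s` steps. -/
def rotation (s t : ℕ) : ℕ := if t < 5 then (t + s) % 5 else t

/-- An edge and a diagonal of the pentagon `0, 1, 2, 3, 4`. -/
def basePairs : List (ℕ × ℕ) := [(0, 1), (0, 2)]

/-- The other edges and diagonals of the pentagon, each with a rotation that takes an
element of `basePairs` to it. -/
def rotatedPairs : List ((ℕ × ℕ) × ℕ × (ℕ × ℕ)) :=
  [((1, 2), 1, (0, 1)), ((2, 3), 2, (0, 1)), ((3, 4), 3, (0, 1)), ((0, 4), 4, (0, 1)),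
    ((1, 3), 1, (0, 2)), ((2, 4), 2, (0, 2)), ((0, 3), 3, (0, 2)), ((1, 4), 4, (0, 2))]

theorem defect_keysIn : defect.KeysIn (basePairs ++ rotatedPairs.map fun r => r.1) := by
  decide +kernel

theorem defect_ok : ∀ π ∈ basePairs, ∀ t ∈ defect.extract π, t.2.Ok 3 [0, 1, 2, 3, 4, 6] := by
  decide +kernel

theorem defect_relabel_ok : ∀ π ∈ basePairs, ∀ t ∈ defect.extract π,
    (t.2.relabel (reflection π.1 π.2)).Ok 3 [0, 1, 2, 3, 4, 6] := by
  decide +kernel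

/-- The antisymmetry that makes the coefficient of an edge or a diagonal vanish, and not just
constant. -/
theorem defect_antisymm : ∀ π ∈ basePairs,
    Cancels (defect.extract π ++ relabelL (reflection π.1 π.2) (defect.extract π)) := by
  decide +kernel

theorem defect_closed : ∀ π ∈ basePairs, Closed3 (defect.extract π) := by
  decide +kernel

theorem defect_rotation : ∀ r ∈ rotatedPairs, Cancels (defect.extract r.1 ++
    scale (-1) (relabelL (rotation r.2.1) (defect.extract r.2.2))) := by
  decide +kernel

theorem reflection_eq_six (i j t : ℕ) : reflection i j t = 6 ↔ t = 6 := by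
  unfold reflection
  split_ifs <;> omega

theorem rotation_eq_six (s t : ℕ) : rotation s t = 6 ↔ t = 6 := by
  unfold rotation
  split_ifs <;> omega

end Formal

/-! ### The cobracket of `f` -/

section Cobracket

variable {K : Type u} [Field K]

theorem Generic.comp {p : ℕ → K} {S T : List ℕ} (hp : Generic p S) {σ : ℕ → ℕ}
    (hσ : ∀ i, σ i = 6 ↔ i = 6) (hT : ∀ i ∈ T, σ i ∈ S)
    (hinj : ∀ i ∈ T, ∀ j ∈ T, σ i = σ j → i = j) : Generic (p ∘ σ) T := by
  intro i hi j hj hij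
  rw [det_comp p hσ]
  exact hp _ (hT i hi) _ (hT j hj) fun h => hij (hinj i hi j hj h)

/-- The formula for the component in `H_3 ⊗ H_1` of the cobracket of `20 f`. -/
theorem defect_eval {p : ℕ → K} (hp : Generic p [0, 1, 2, 3, 4, 6]) :
    defect.eval (TensorProduct.mk ℚ (H 3 K) (H 1 K)) (hypC 3 p) (lgAt p) = 0 := by
  have base : ∀ q : ℕ → K, Generic q [0, 1, 2, 3, 4, 6] → ∀ π ∈ basePairs,
      lsum (defect.extract π) (hypC 3 q) = 0 := fun q hq π hπ =>
    (defect_closed π hπ).lsum_eq_zero hq (reflection_eq_six π.1 π.2) (defect_ok π hπ)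
      (defect_relabel_ok π hπ) (defect_antisymm π hπ)
  refine FTensor.eval_eq_zero _ _ _ _ _ defect_keysIn fun π hπ => ?_
  rcases List.mem_append.1 hπ with hπ | hπ
  · exact base p hp π hπ
  · obtain ⟨⟨π', s, β⟩, hr, rfl⟩ := List.mem_map.1 hπ
    have h1 := (defect_rotation _ hr).lsum_eq_zero (hypC 3 p)
    have hβ : β ∈ basePairs := by
      have : ∀ r ∈ rotatedPairs, r.2.2 ∈ basePairs := by decide
      exact this _ hr
    have hs : s < 5 := by
      have : ∀ r ∈ rotatedPairs, r.2.1 < 5 := by decide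
      exact this _ hr
    have hq : Generic (p ∘ rotation s) [0, 1, 2, 3, 4, 6] := by
      refine hp.comp (rotation_eq_six s) ?_ ?_
      · interval_cases s <;> decide
      · interval_cases s <;> decide
    have h2 := base _ hq β hβ
    rw [lsum_hypC_comp 3 p (rotation_eq_six s)] at h2
    rw [lsum_append, lsum_scale, h2, smul_zero, add_zero] at h1
    exact h1

/-- Pure powers of a logarithm vanish. -/
theorem hyp_three_repeat {o z x : K} (ho : o ≠ z) (hx : z ≠ x) :
    hyp 3 o [z, z, z] x = 0 := by
  let X : Fin 3 → RatFunc K := fun i => segment (![o, z, x] i) (![o, z, o] i)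
  have h0 : ∀ i, Spec 0 (X i) (![o, z, x] i) := fun i => spec_segment_zero _ _
  have h1 : ∀ i, Spec 1 (X i) (![o, z, o] i) := fun i => spec_segment_one _ _
  let s : FSymb (Fin 3) := (0, [1, 1, 1], 2)
  have c0 : ConvAt 3 ![o, z, x] s := ⟨rfl, by simpa [s] using ho.symm, by simpa [s] using hx⟩
  have c1 : ConvAt 3 ![o, z, o] s := ⟨rfl, by simpa [s] using ho.symm, by simpa [s] using ho.symm⟩
  have := lsum_hypAt_eq_of_delta 1 [(1, s)] _ _ X (by simpa using ⟨c0, c1⟩)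
    (fun t _ i _ => ⟨h0 i, h1 i⟩) (fun k hk => ?_) (fun k hk => by omega)
  · simp only [lsum_cons, lsum_nil, one_smul, add_zero] at this
    change hyp 3 o [z, z, z] x = hyp 3 o [z, z, z] o at this
    rw [this, hyp_constant_path 1]
  · obtain rfl : k = 1 := by omega
    have cX : IsConvergent 3 (X 0) [X 1, X 1, X 1] (X 2) := conv_of_spec c0 fun i _ => h0 i
    simp only [lsum_cons, lsum_nil, one_smul, add_zero]
    refine (delta_three cX).trans ?_
    simp [dilog_eq_zero]

/-- Reversal of the path in weight three. -/
theorem hyp_three_reverse {p : ℕ → K} (hp : Generic p [0, 1, 2, 3, 4]) :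
    hyp 3 (p 4) [p 3, p 2, p 1] (p 0) = -hyp 3 (p 0) [p 1, p 2, p 3] (p 4) := by
  let L : List (ℤ × CSymb) := [(1, (Chart.affine, 0, [1, 2, 3], 4)),
    (1, (Chart.affine, 4, [3, 2, 1], 0))]
  have hL : Closed3 L := by decide +kernel
  -- at the end of the path both symbols are integrals over a constant path
  have := hL.lsum_relabel hp (σ := fun t => if t = 4 then 0 else t)
    (fun i => show (if i = 4 then 0 else i) = 6 ↔ i = 6 by by_cases h : i = 4 <;> simp [h])
    (by decide) (by decide)
  simp only [L, relabelL, List.map_cons, List.map_nil, lsum_cons, lsum_nil, one_smul, add_zero] at this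
  change hyp 3 (p 0) [p 1, p 2, p 3] (p 4) + hyp 3 (p 4) [p 3, p 2, p 1] (p 0) =
    hyp 3 (p 0) [p 1, p 2, p 3] (p 0) + hyp 3 (p 0) [p 3, p 2, p 1] (p 0) at this
  rw [hyp_constant_path 1, hyp_constant_path 1, add_zero] at this
  exact eq_neg_of_add_eq_zero_right this

/-- The inversion relation of the trilogarithm. -/
theorem trilog_inv {p : ℕ → K} {S : List ℕ} (hp : Generic p S) {Z O X : ℕ}
    (hn : [6, Z, O, X].Nodup) (hS : ∀ i ∈ [6, Z, O, X], i ∈ S) :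
    hypC 3 p (Chart.proj 6 Z O, Z, [O, Z, Z], X) =
      hypC 3 p (Chart.proj 6 Z X, Z, [X, Z, Z], O) := by
  let σ : ℕ → ℕ := fun i => if i = 0 then Z else if i = 1 then O else if i = 2 then X else i
  simp only [List.nodup_cons, List.mem_cons, List.not_mem_nil, or_false, not_or, not_false_eq_true,
    List.nodup_nil, and_true] at hn
  obtain ⟨⟨h6Z, h6O, h6X⟩, ⟨hZO, hZX⟩, hOX⟩ := hn
  simp only [List.mem_cons, List.not_mem_nil, or_false, forall_eq_or_imp, forall_eq] at hS
  obtain ⟨h6, hZ, hO, hX⟩ := hS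
  have hσ : ∀ i, σ i = 6 ↔ i = 6 := by
    intro i; simp only [σ]; split_ifs <;> omega
  have hq : Generic (p ∘ σ) [0, 1, 2, 6] := by
    refine hp.comp hσ ?_ ?_
    · simp [σ, h6, hZ, hO, hX]
    · simp only [List.mem_cons, List.not_mem_nil, or_false, forall_eq_or_imp, forall_eq, σ]
      simp [hZO, hZX, hOX, h6Z, h6O, h6X, Ne.symm hZO, Ne.symm hZX, Ne.symm hOX, Ne.symm h6Z,
        Ne.symm h6O, Ne.symm h6X]
  let L : List (ℤ × CSymb) := [(1, (Chart.proj 6 0 1, 0, [1, 0, 0], 2)),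
    (-1, (Chart.proj 6 0 2, 0, [2, 0, 0], 1))]
  have hL : Closed3 L := by decide +kernel
  have := hL.lsum_eq_zero hq (σ := fun t => if t = 1 then 2 else if t = 2 then 1 else t)
    (fun i => show (if i = 1 then 2 else if i = 2 then 1 else i) = 6 ↔ i = 6 by
      split_ifs <;> omega) (by decide) (by decide) (by decide +kernel)
  simp only [L, lsum_cons, lsum_nil, one_smul, neg_smul, add_zero, hypC_comp 3 p hσ] at this
  exact eq_of_sub_eq_zero (by rw [sub_eq_add_neg]; exact this)

/-- Regularization does not change a convergent symbol. -/
theorem cls_of_conv {n : ℕ} {a b : K} {w : List K} (h : IsConvergent (n + 2) a w b) :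
    cls (relations (n + 2) K) a w b = hyp (n + 2) a w b := by
  have h0 : w ≠ [] := by rintro rfl; exact absurd h.1 (by simp)
  have h1 : reg (n + 2) a w b = regShuffle (n + 2) a w b := by
    rcases w with _ | ⟨x, _ | ⟨y, w⟩⟩ <;> rfl
  rw [cls, h1, regShuffle_of_conv h h0, hyp]

omit [Field K] in
theorem conv_three {a x y z b : K} (h1 : a ≠ x) (h2 : z ≠ b) : IsConvergent 3 a [x, y, z] b := by
  simpa [IsConvergent] using ⟨h1.symm, h2⟩

omit [Field K] in
theorem conv_four {a x y z u b : K} (h1 : a ≠ x) (h2 : u ≠ b) :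
    IsConvergent 4 a [x, y, z, u] b := by
  simpa [IsConvergent] using ⟨h1.symm, h2⟩

/-- The component in `H_3 ⊗ H_1` of the cobracket of `[v | x, v, v, y | w]`, which is `[x, y]_{3,1}`
in the coordinate with `v = 0` and `w = 1`. -/
theorem delta_li31 {v w x y : K} (hvx : v ≠ x) (hvy : v ≠ y) (hvw : v ≠ w) (hyw : y ≠ w) :
    delta 4 (relations 3 K) (relations 1 K) (symb 4 v [x, v, v, y] w) =
      hyp 3 v [x, v, y] w ⊗ₜ[ℚ] (lg (y - v) - lg (x - v))
      + (hyp 3 v [x, v, v] w - hyp 3 v [x, v, v] y) ⊗ₜ[ℚ] (lg (w - y) - lg (y - v))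
      - hyp 3 x [v, v, y] w ⊗ₜ[ℚ] (lg (w - x) - lg (x - v)) := by
  rw [delta_symb 4 _ _ (conv_four hvx hyw)]
  simp [coprod, Finset.sum_range_succ, cls_one]
  rw [cls_of_conv (conv_three hvx hyw), cls_of_conv (conv_three hvx hvw),
    cls_of_conv (conv_three hvx hvy), cls_of_conv (conv_three hvx.symm hyw),
    lg_sub_comm v y, lg_sub_comm v x]
  simp only [TensorProduct.tmul_sub, TensorProduct.sub_tmul, TensorProduct.tmul_neg]
  abel

/-- The component in `H_3 ⊗ H_1` of the cobracket of a `4`-logarithm. -/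
theorem delta_li4 {z o x : K} (hzo : z ≠ o) (hzx : z ≠ x) :
    delta 4 (relations 3 K) (relations 1 K) (symb 4 z [o, z, z, z] x) =
      hyp 3 z [o, z, z] x ⊗ₜ[ℚ] (lg (x - z) - lg (o - z)) := by
  have h0 : cls (relations 3 K) z [o, z, z] z = 0 := by
    have h1 : regShuffle 3 z [o, z, z] z = 0 := by
      rw [regShuffle, regLeft_of_ne (by simpa using hzo.symm) (by simp),
        Finsupp.sum_single_index (by simp)]
      have h2 : regRight z [o, z, z] = Finsupp.single [z, z, o] 1 := by
        simp [regRight, regLeft, hzo.symm, shuffle, Finsupp.mapDomain_single]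
      rw [h2, Finsupp.sum_single_index (by simp), symb_of_not_conv (by simp [IsConvergent]),
        smul_zero]
    change (relations 3 K).mkQ (regShuffle 3 z [o, z, z] z) = 0
    rw [h1, map_zero]
  rw [delta_symb 4 _ _ (conv_four hzo hzx)]
  simp [coprod, Finset.sum_range_succ, cls_one, h0]
  rw [cls_of_conv (conv_three hzo hzx), cls_of_conv (conv_three hzo.symm hzx),
    hyp_three_repeat hzo.symm hzx]
  simp only [TensorProduct.tmul_sub, TensorProduct.zero_tmul, TensorProduct.tmul_neg]
  abel

/-- The indices of the points of a building block are distinct and belong to `S`. -/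
def Block.Ok (S : List ℕ) : Block → Prop
  | .li31 U V W X Y => [U, V, W, X, Y].Nodup ∧ ∀ i ∈ [U, V, W, X, Y], i ∈ S
  | .li4 Z O X => [6, Z, O, X].Nodup ∧ ∀ i ∈ [6, Z, O, X], i ∈ S

instance (S : List ℕ) (b : Block) : Decidable (b.Ok S) := by
  cases b <;> unfold Block.Ok <;> infer_instance

/-- The cobracket of a building block agrees with the formal one. -/
theorem delta_block {p : ℕ → K} {S : List ℕ} (hp : Generic p S) {b : Block} (hb : b.Ok S) :
    delta 4 (relations 3 K) (relations 1 K)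
        (lsum b.symbols fun t => symbAt 4 (coord p) t.toF) =
      b.cobracket.eval (TensorProduct.mk ℚ (H 3 K) (H 1 K)) (hypC 3 p) (lgAt p) := by
  cases b with
  | li31 U V W X Y =>
    obtain ⟨hn, hS⟩ := hb
    simp only [List.nodup_cons, List.mem_cons, List.not_mem_nil, or_false, not_or,
      not_false_eq_true, List.nodup_nil, and_true] at hn
    obtain ⟨⟨hUV, hUW, hUX, hUY⟩, ⟨hVW, hVX, hVY⟩, ⟨hWX, hWY⟩, hXY⟩ := hn
    simp only [List.mem_cons, List.not_mem_nil, or_false, forall_eq_or_imp, forall_eq] at hS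
    obtain ⟨hU, hV, hW, hX, hY⟩ := hS
    have hc : (Chart.proj U V W).Ok S := ⟨hU, hV, hW, hUV, hVW, hUW⟩
    have fV : (Chart.proj U V W).Fin S V := ⟨hV, Ne.symm hUV⟩
    have fW : (Chart.proj U V W).Fin S W := ⟨hW, Ne.symm hUW⟩
    have fX : (Chart.proj U V W).Fin S X := ⟨hX, Ne.symm hUX⟩
    have fY : (Chart.proj U V W).Fin S Y := ⟨hY, Ne.symm hUY⟩
    simp only [Block.symbols, Block.cobracket, lsum_cons, lsum_nil, one_smul, add_zero, neg_smul,
      FTensor.eval_cons, FTensor.eval_nil, lsum_append, lsum_scale, lsum_logL hp hc fY fV,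
      lsum_logL hp hc fX fV, lsum_logL hp hc fW fY, lsum_logL hp hc fW fX, TensorProduct.mk_apply]
    refine (delta_li31 (coord_injOn hp hc fV fX hVX) (coord_injOn hp hc fV fY hVY)
      (coord_injOn hp hc fV fW hVW) (coord_injOn hp hc fY fW (Ne.symm hWY))).trans ?_
    rw [TensorProduct.neg_tmul]
    simp only [← sub_eq_add_neg, add_sub_assoc]
    rfl
  | li4 Z O X =>
    obtain ⟨hn, hS⟩ := hb
    have hinv := trilog_inv hp hn hS
    simp only [List.nodup_cons, List.mem_cons, List.not_mem_nil, or_false, not_or,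
      not_false_eq_true, List.nodup_nil, and_true] at hn
    obtain ⟨⟨h6Z, h6O, h6X⟩, ⟨hZO, hZX⟩, hOX⟩ := hn
    simp only [List.mem_cons, List.not_mem_nil, or_false, forall_eq_or_imp, forall_eq] at hS
    obtain ⟨h6, hZ, hO, hX⟩ := hS
    have hc : (Chart.proj 6 Z O).Ok S := ⟨h6, hZ, hO, h6Z, hZO, h6O⟩
    have fZ : (Chart.proj 6 Z O).Fin S Z := ⟨hZ, Ne.symm h6Z⟩
    have fO : (Chart.proj 6 Z O).Fin S O := ⟨hO, Ne.symm h6O⟩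
    have fX : (Chart.proj 6 Z O).Fin S X := ⟨hX, Ne.symm h6X⟩
    have hone : lg (coord p (Chart.proj 6 Z O, O) - coord p (Chart.proj 6 Z O, Z)) = 0 := by
      have h1 := hp 6 h6 O hO h6O
      have h2 := hp Z hZ O hO hZO
      simp [coord, det_self, h1, h2]
    simp only [Block.symbols, Block.cobracket, lsum_cons, lsum_nil, add_zero, neg_smul,
      FTensor.eval_cons, FTensor.eval_nil, lsum_logL hp hc fX fZ, TensorProduct.mk_apply, ← hinv,
      one_smul, map_neg, map_zsmul]
    rw [show symbAt 4 (coord p) (CSymb.toF (Chart.proj 6 Z O, Z, [O, Z, Z, Z], X)) =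
      symb 4 (coord p (Chart.proj 6 Z O, Z)) [coord p (Chart.proj 6 Z O, O),
        coord p (Chart.proj 6 Z O, Z), coord p (Chart.proj 6 Z O, Z), coord p (Chart.proj 6 Z O, Z)]
        (coord p (Chart.proj 6 Z O, X)) from rfl,
      delta_li4 (coord_injOn hp hc fZ fO hZO) (coord_injOn hp hc fZ fX hZX), hone, sub_zero,
      ← neg_add, TensorProduct.neg_tmul, TensorProduct.add_tmul, ← two_smul ℤ]
    rfl

end Cobracket

/-! ### The component of the cobracket in `Λ² H_2` -/

section Wedge

/-- The formal component in `Λ² H_2` of the cobracket of a symbol of weight four. -/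
def cobracketWedge : CSymb → FTensor (ℕ × ℕ × ℕ) (ℕ × ℕ × ℕ)
  | (c, a, [x, y, z, u], b) => [(h2L c a z u b, h2L c a x y z), (h2L c a x u b, h2L c x y z u),
      (h2L c a x y b, h2L c y z u b)]
  | _ => []

/-- The formal version of `20 ∑ F(A, B, C) ∧ F(C, D, E)` (cyclic sum). -/
def psiWedge : ℕ → ℕ → ℕ → ℕ → ℕ → FTensor (ℕ × ℕ × ℕ) (ℕ × ℕ × ℕ) :=
  cyclL fun A B C D E => [(scale 20 (tripL A B C), tripL C D E)]

/-- The triples of finite points. -/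
def triples : List (ℕ × ℕ × ℕ) := [(0, 1, 2), (0, 1, 3), (0, 1, 4), (0, 1, 5), (0, 2, 3), (0, 2, 4),
  (0, 2, 5), (0, 3, 4), (0, 3, 5), (0, 4, 5), (1, 2, 3), (1, 2, 4), (1, 2, 5), (1, 3, 4), (1, 3, 5),
  (1, 4, 5), (2, 3, 4), (2, 3, 5), (2, 4, 5), (3, 4, 5)]

/-- The coefficients of a formal tensor are symmetric, so that its image in `Λ²` vanishes. -/
def FTensor.Symmetric (Q : FTensor (ℕ × ℕ × ℕ) (ℕ × ℕ × ℕ)) : Prop :=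
  Q.KeysIn triples ∧ (∀ τ ∈ triples, ∀ t ∈ Q.extract τ, t.2 ∈ triples) ∧
    ∀ τ ∈ triples, ∀ τ' ∈ triples,
      coefAt τ (collect (Q.extract τ')) = coefAt τ' (collect (Q.extract τ))

instance (Q : FTensor (ℕ × ℕ × ℕ) (ℕ × ℕ × ℕ)) : Decidable Q.Symmetric := by
  unfold FTensor.Symmetric; infer_instance

/-- The difference of the two sides of the formula for the component in `Λ² H_2` of the cobracket
of `20 f`. -/
def wedgeDefect : FTensor (ℕ × ℕ × ℕ) (ℕ × ℕ × ℕ) :=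
  FTensor.bind (lbind (fL 0 1 2 3 4) Block.symbols) cobracketWedge ++ (psiWedge 0 1 2 3 4).smul (-1)

theorem wedgeDefect_symmetric : wedgeDefect.Symmetric := by decide +kernel

theorem generic_wedge_symmetric : FTensor.Symmetric
    ((cobracketWedge (Chart.affine, 0, [1, 2, 3, 4], 5)).smul 20 ++
      (psiWedge 0 1 2 3 4).smul (-1) ++ psiWedge 1 2 3 4 5) := by decide +kernel

theorem coefAt_collectInsert {α : Type*} [DecidableEq α] (c : ℤ) (s π : α) (L : List (ℤ × α)) :
    coefAt π (collectInsert c s L) = (if s = π then c else 0) + coefAt π L := by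
  induction L with
  | nil => simp [collectInsert, coefAt]
  | cons t L ih =>
    unfold collectInsert
    by_cases h : t.2 = s
    · by_cases h' : t.1 + c = 0
      · rw [if_pos h, if_pos h', coefAt, h]
        split_ifs
        · rw [← add_assoc, add_comm c, h', zero_add]
        · rw [zero_add]
      · rw [if_pos h, if_neg h', coefAt, coefAt, h]
        split_ifs <;> ring
    · rw [if_neg h, coefAt, coefAt, ih]
      split_ifs <;> ring

theorem coefAt_collect {α : Type*} [DecidableEq α] (π : α) (L : List (ℤ × α)) :
    coefAt π (collect L) = coefAt π L := by
  induction L with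
  | nil => rfl
  | cons t L ih =>
    rw [collect, coefAt_collectInsert, ih, coefAt]
    split_ifs <;> simp

variable {K : Type u} [Field K]

/-- The product of two elements of weight two in the exterior algebra. -/
noncomputable def wedgeMap (M : Type*) [AddCommGroup M] [Module ℚ M] :
    M →ₗ[ℚ] M →ₗ[ℚ] ExteriorAlgebra ℚ M :=
  (LinearMap.mul ℚ (ExteriorAlgebra ℚ M)).compl₁₂ (ExteriorAlgebra.ι ℚ) (ExteriorAlgebra.ι ℚ)

theorem wedgeMap_apply {M : Type*} [AddCommGroup M] [Module ℚ M] (x y : M) :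
    wedgeMap M x y = ExteriorAlgebra.ι ℚ x * ExteriorAlgebra.ι ℚ y := rfl

theorem FTensor.Symmetric.eval_eq_zero {M : Type*} [AddCommGroup M] [Module ℚ M]
    {Q : FTensor (ℕ × ℕ × ℕ) (ℕ × ℕ × ℕ)} (hQ : Q.Symmetric) (f : ℕ × ℕ × ℕ → M) :
    Q.eval (wedgeMap M) f f = 0 := by
  have h1 : Q.eval (wedgeMap M) f f = ∑ τ ∈ triples.toFinset, ∑ τ' ∈ triples.toFinset,
      coefAt τ' (Q.extract τ) • wedgeMap M (f τ') (f τ) := by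
    rw [FTensor.eval_eq_sum_extract (wedgeMap M) f f triples Q hQ.1]
    refine Finset.sum_congr rfl fun τ hτ => ?_
    rw [lsum_eq_sum_coefAt f triples.toFinset (Q.extract τ) fun t ht => by
      simpa using hQ.2.1 τ (by simpa using hτ) t ht]
    simp only [map_sum, LinearMap.sum_apply, map_zsmul, LinearMap.smul_apply]
  have h2 : Q.eval (wedgeMap M) f f = -Q.eval (wedgeMap M) f f := by
    conv_rhs => rw [h1, Finset.sum_comm]
    rw [h1, ← Finset.sum_neg_distrib]
    refine Finset.sum_congr rfl fun τ hτ => ?_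
    rw [← Finset.sum_neg_distrib]
    refine Finset.sum_congr rfl fun τ' hτ' => ?_
    have := hQ.2.2 τ (by simpa using hτ) τ' (by simpa using hτ')
    rw [coefAt_collect, coefAt_collect] at this
    rw [this, wedgeMap_apply, wedgeMap_apply, ι_mul_comm (f τ), smul_neg]
  have h3 : (2 : ℚ) • Q.eval (wedgeMap M) f f = 0 := by
    rw [two_smul]
    nth_rewrite 1 [h2]
    exact neg_add_cancel _
  simpa using h3

variable [Infinite K]

theorem deltaWedge_four_formal {p : ℕ → K} {S : List ℕ} (hp : Generic p S) {t : CSymb}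
    (ht : t.Ok 4 S) :
    deltaWedge 4 (relations 2 K) (symbAt 4 (coord p) t.toF) =
      (cobracketWedge t).eval (wedgeMap (H 2 K)) (dilogAt p) (dilogAt p) := by
  have hconv := ht.conv hp
  obtain ⟨c, a, w, b⟩ := t
  obtain ⟨hc, hl, hlen, -, -⟩ := ht
  obtain ⟨x, y, z, u, rfl⟩ : ∃ x y z u, w = [x, y, z, u] := by
    simp only at hlen
    match w, hlen with
    | [x, y, z, u], _ => exact ⟨x, y, z, u, rfl⟩
  have ha := hl a (by simp [letters])
  have hb := hl b (by simp [letters])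
  have hx := hl x (by simp [letters])
  have hy := hl y (by simp [letters])
  have hz := hl z (by simp [letters])
  have hu := hl u (by simp [letters])
  simp only at hc ha hb hx hy hz hu
  refine (deltaWedge_symb 4 (relations 2 K) hconv).trans ?_
  simp only [cobracketWedge, FTensor.eval_cons, FTensor.eval_nil, wedgeMap_apply,
    lsum_h2L hp hc ha hz hu hb, lsum_h2L hp hc ha hx hy hz, lsum_h2L hp hc ha hx hu hb,
    lsum_h2L hp hc hx hy hz hu, lsum_h2L hp hc ha hx hy hb, lsum_h2L hp hc hy hz hu hb]
  simp [CSymb.toF, Finset.sum_range_succ, cls_two]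
  abel

end Wedge

/-! ### The cobracket of a generic symbol of weight four -/

section GenericSymbol

/-- The formal version of `∑ [A | B, C, D | E] ⊗ (E - A)` (cyclic sum). -/
def psiT : ℕ → ℕ → ℕ → ℕ → ℕ → FTensor CSymb (ℕ × ℕ) := cyclL fun A B C D E =>
  [([(1, (Chart.affine, A, [B, C, D], E))], pairL E A)]

/-- The component in `H_3 ⊗ H_1` of the cobracket of `[0 | 1, 2, 3, 4 | 5]`. -/
def genericL : FTensor CSymb (ℕ × ℕ) :=
  [([(1, (Chart.affine, 0, [2, 3, 4], 5))], h1L Chart.affine 0 1 2),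
    ([(1, (Chart.affine, 0, [1, 3, 4], 5))], h1L Chart.affine 1 2 3),
    ([(1, (Chart.affine, 0, [1, 2, 4], 5))], h1L Chart.affine 2 3 4),
    ([(1, (Chart.affine, 0, [1, 2, 3], 5))], h1L Chart.affine 3 4 5),
    ([(-1, (Chart.affine, 0, [1, 2, 3], 4))], h1L Chart.affine 0 4 5),
    ([(-1, (Chart.affine, 1, [2, 3, 4], 5))], h1L Chart.affine 0 1 5)]

/-- The difference of the two sides of the formula for the component in `H_3 ⊗ H_1` of the
cobracket of `[0 | 1, 2, 3, 4 | 5]`. -/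
def genericDefect : FTensor CSymb (ℕ × ℕ) :=
  genericL ++ (psiT 0 1 2 3 4).smul (-1) ++ psiT 1 2 3 4 5

/-- The substitution that moves the point `5` to the point `0`. -/
def closeUp (t : ℕ) : ℕ := if t = 5 then 0 else t

theorem closeUp_eq_six (t : ℕ) : closeUp t = 6 ↔ t = 6 := by
  by_cases h : t = 5 <;> simp [closeUp, h]

/-- The symbol is not an integral over a constant path. -/
def CSymb.Open (t : CSymb) : Prop := t.2.1 ≠ t.2.2.2

instance (t : CSymb) : Decidable t.Open := by unfold CSymb.Open; infer_instance

theorem genericDefect_keysIn : genericDefect.KeysIn pairs := by decide +kernel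

theorem genericDefect_ok : ∀ π ∈ pairs, ∀ t ∈ genericDefect.extract π,
    t.2.Ok 3 [0, 1, 2, 3, 4, 5, 6] ∧ (t.2.relabel closeUp).Ok 3 [0, 1, 2, 3, 4, 5, 6] := by
  decide +kernel

theorem genericDefect_closed : ∀ π ∈ pairs, Closed3 (genericDefect.extract π) := by
  decide +kernel

/-- When the point `5` is moved to `0`, the coefficients become sums of integrals over constant
paths. -/
theorem genericDefect_closeUp : ∀ π ∈ pairs,
    Cancels ((relabelL closeUp (genericDefect.extract π)).filter fun t => t.2.Open) := by
  decide +kernel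

variable {K : Type u} [Field K]

theorem lsum_filter_open (n : ℕ) (p : ℕ → K) (L : List (ℤ × CSymb)) :
    lsum (L.filter fun t => t.2.Open) (hypC (n + 2) p) = lsum L (hypC (n + 2) p) := by
  induction L with
  | nil => rfl
  | cons t L ih =>
    by_cases h : t.2.Open
    · rw [List.filter_cons_of_pos (by simpa using h), lsum_cons, lsum_cons, ih]
    · rw [List.filter_cons_of_neg (by simpa using h), lsum_cons, ih]
      have h1 : t.2.2.1 = t.2.2.2.2 := not_not.1 h
      have h2 : hypC (n + 2) p t.2 = 0 := by
        have : hypC (n + 2) p t.2 = hyp (n + 2) (coord p (t.2.1, t.2.2.1))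
          (t.2.toF.2.1.map (coord p)) (coord p (t.2.1, t.2.2.2.2)) := rfl
        rw [this, h1, hyp_constant_path]
      rw [h2, smul_zero, zero_add]

theorem genericDefect_eval {p : ℕ → K} (hp : Generic p [0, 1, 2, 3, 4, 5, 6]) :
    genericDefect.eval (TensorProduct.mk ℚ (H 3 K) (H 1 K)) (hypC 3 p) (lgAt p) = 0 := by
  refine FTensor.eval_eq_zero _ _ _ _ _ genericDefect_keysIn fun π hπ => ?_
  rw [(genericDefect_closed π hπ).lsum_relabel hp closeUp_eq_six
    (fun t ht => (genericDefect_ok π hπ t ht).1) (fun t ht => (genericDefect_ok π hπ t ht).2),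
    ← lsum_filter_open 1, (genericDefect_closeUp π hπ).lsum_eq_zero]

/-- The component in `H_3 ⊗ H_1` of the cobracket of `[0 | 1, 2, 3, 4 | 5]`, in formal terms. -/
theorem delta_generic {p : ℕ → K} (hp : Generic p [0, 1, 2, 3, 4, 5, 6]) :
    delta 4 (relations 3 K) (relations 1 K)
        (symbAt 4 (coord p) (CSymb.toF (Chart.affine, 0, [1, 2, 3, 4], 5))) =
      genericL.eval (TensorProduct.mk ℚ (H 3 K) (H 1 K)) (hypC 3 p) (lgAt p) := by
  have hne : ∀ {i j : ℕ}, i < 6 → j < 6 → i ≠ j → p i ≠ p j := by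
    intro i j hi hj hij
    have h1 : ∀ i < 6, i ∈ [0, 1, 2, 3, 4, 5, 6] := by decide
    have := hp i (h1 i hi) j (h1 j hj) hij
    rw [det_fin p (by omega) (by omega)] at this
    exact sub_ne_zero.1 this
  have hf : ∀ {i : ℕ}, i < 6 → Chart.affine.Fin [0, 1, 2, 3, 4, 5, 6] i := by
    intro i hi
    have h1 : ∀ i < 6, i ∈ [0, 1, 2, 3, 4, 5, 6] := by decide
    exact ⟨h1 i hi, by omega⟩
  have hl : ∀ {a x b : ℕ}, a < 6 → x < 6 → b < 6 → lsum (h1L Chart.affine a x b) (lgAt p) =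
      lg (p b - p x) - lg (p a - p x) := fun ha hx hb =>
    lsum_h1L hp (c := Chart.affine) trivial (hf ha) (hf hx) (hf hb)
  have hy : ∀ a x y z b : ℕ, hypC 3 p (Chart.affine, a, [x, y, z], b) =
    hyp 3 (p a) [p x, p y, p z] (p b) := fun _ _ _ _ _ => rfl
  have hc : ∀ {a x y z b : ℕ}, a < 6 → x < 6 → z < 6 → b < 6 → a ≠ x → z ≠ b →
      cls (relations 3 K) (p a) [p x, p y, p z] (p b) = hyp 3 (p a) [p x, p y, p z] (p b) :=
    fun ha hx hz hb h1 h2 => cls_of_conv (conv_three (hne ha hx h1) (hne hz hb h2))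
  change delta 4 (relations 3 K) (relations 1 K) (symb 4 (p 0) [p 1, p 2, p 3, p 4] (p 5)) = _
  rw [delta_symb 4 _ _ (conv_four (hne (by omega) (by omega) (by omega))
    (hne (by omega) (by omega) (by omega)))]
  simp [coprod, Finset.sum_range_succ, cls_one, genericL, hl, hy, hc]
  abel

theorem psiL_eval {p : ℕ → K} (hp : Generic p [0, 1, 2, 3, 4, 6]) :
    (psiL 0 1 2 3 4).eval (TensorProduct.mk ℚ (H 3 K) (H 1 K)) (hypC 3 p) (lgAt p) =
      (20 : ℤ) • (psiT 0 1 2 3 4).eval (TensorProduct.mk ℚ (H 3 K) (H 1 K)) (hypC 3 p) (lgAt p) := by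
  have hrev : ∀ s < 5, hyp 3 (p (rotation s 4)) [p (rotation s 3), p (rotation s 2),
      p (rotation s 1)] (p (rotation s 0)) = -hyp 3 (p (rotation s 0)) [p (rotation s 1),
      p (rotation s 2), p (rotation s 3)] (p (rotation s 4)) := by
    intro s hs
    refine hyp_three_reverse (p := p ∘ rotation s) (hp.comp (rotation_eq_six s) ?_ ?_)
    · interval_cases s <;> decide
    · interval_cases s <;> decide
  have hy : ∀ a x y z b : ℕ, hypC 3 p (Chart.affine, a, [x, y, z], b) =
    hyp 3 (p a) [p x, p y, p z] (p b) := fun _ _ _ _ _ => rfl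
  have r0 := hrev 0 (by omega)
  have r1 := hrev 1 (by omega)
  have r2 := hrev 2 (by omega)
  have r3 := hrev 3 (by omega)
  have r4 := hrev 4 (by omega)
  simp only [rotation, Nat.reduceLT, if_true, Nat.reduceAdd, Nat.reduceMod] at r0 r1 r2 r3 r4
  simp only [psiL, psiT, cyclL, List.cons_append, List.nil_append, FTensor.eval_cons,
    FTensor.eval_nil, lsum_cons, lsum_nil, add_zero, hy, r0, r1, r2, r3, r4, smul_add, smul_neg,
    neg_smul, neg_neg, ← add_smul, one_smul, ← LinearMap.smul_apply]
  norm_num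

end GenericSymbol

/-! ### The cobracket of the formula -/

section Formula

/-- The substitution that moves every finite point to the next one. -/
def shift (t : ℕ) : ℕ := if t < 6 then (t + 1) % 6 else t

theorem shift_eq_six (t : ℕ) : shift t = 6 ↔ t = 6 := by
  unfold shift
  split_ifs <;> omega

/-- The symbols of `20 f(0, 1, 2, 3, 4)`. -/
def fSymbols : List (ℤ × CSymb) := lbind (fL 0 1 2 3 4) Block.symbols

/-- The symbols of `20 ([0 | 1, 2, 3, 4 | 5] - f(0, 1, 2, 3, 4) + f(1, 2, 3, 4, 5))`. -/
def formula : List (ℤ × CSymb) :=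
  (20, (Chart.affine, 0, [1, 2, 3, 4], 5)) :: (scale (-1) fSymbols ++ relabelL shift fSymbols)

theorem fL_ok : ∀ t ∈ fL 0 1 2 3 4, t.2.Ok [0, 1, 2, 3, 4, 6] := by decide +kernel

theorem fSymbols_ok : ∀ t ∈ fSymbols, t.2.Ok 4 [0, 1, 2, 3, 4, 6] := by decide +kernel

theorem formula_ok : ∀ t ∈ formula, t.2.Ok 4 [0, 1, 2, 3, 4, 5, 6] ∧
    (t.2.relabel closeUp).Ok 4 [0, 1, 2, 3, 4, 5, 6] := by decide +kernel

variable {K : Type u} [Field K]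

theorem Generic.left {p : ℕ → K} (hp : Generic p [0, 1, 2, 3, 4, 5, 6]) :
    Generic p [0, 1, 2, 3, 4, 6] := by
  have h : ∀ i ∈ [0, 1, 2, 3, 4, 6], i ∈ [0, 1, 2, 3, 4, 5, 6] := by decide
  exact fun i hi j hj => hp i (h i hi) j (h j hj)

theorem Generic.shift {p : ℕ → K} (hp : Generic p [0, 1, 2, 3, 4, 5, 6]) :
    Generic (p ∘ shift) [0, 1, 2, 3, 4, 6] :=
  hp.comp shift_eq_six (by decide) (by decide)

theorem lsum_symbAt_comp (n : ℕ) (p : ℕ → K) {σ : ℕ → ℕ} (hσ : ∀ i, σ i = 6 ↔ i = 6)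
    (L : List (ℤ × CSymb)) : (lsum L fun t => symbAt n (coord (p ∘ σ)) t.toF) =
      lsum (relabelL σ L) fun t => symbAt n (coord p) t.toF := by
  rw [lsum_relabelL]
  exact lsum_congr fun t _ => toF_comp p hσ t.2 (symb n)

/-- The component in `H_3 ⊗ H_1` of the cobracket of `20 f`. -/
theorem delta_fSymbols {p : ℕ → K} (hp : Generic p [0, 1, 2, 3, 4, 6]) :
    delta 4 (relations 3 K) (relations 1 K)
        (lsum fSymbols fun t => symbAt 4 (coord p) t.toF) =
      (20 : ℤ) • (psiT 0 1 2 3 4).eval (TensorProduct.mk ℚ (H 3 K) (H 1 K)) (hypC 3 p) (lgAt p) := by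
  have h := defect_eval hp
  rw [defect, FTensor.eval_append, FTensor.eval_smul, FTensor.eval_bind, neg_one_smul,
    ← sub_eq_add_neg, sub_eq_zero] at h
  rw [fSymbols, lsum_lbind, map_lsum, lsum_congr (w := fun b => b.cobracket.eval
    (TensorProduct.mk ℚ (H 3 K) (H 1 K)) (hypC 3 p) (lgAt p)) fun t ht =>
      delta_block hp (fL_ok t ht), h, psiL_eval hp]

theorem psiT_shift (p : ℕ → K) :
    (psiT 0 1 2 3 4).eval (TensorProduct.mk ℚ (H 3 K) (H 1 K)) (hypC 3 (p ∘ shift))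
        (lgAt (p ∘ shift)) =
      (psiT 1 2 3 4 5).eval (TensorProduct.mk ℚ (H 3 K) (H 1 K)) (hypC 3 p) (lgAt p) := by
  simp only [psiT, cyclL, List.cons_append, List.nil_append, FTensor.eval_cons, FTensor.eval_nil,
    lsum_cons, lsum_nil, lsum_pairL, det_comp p shift_eq_six, hypC_comp 3 p shift_eq_six]
  rfl

theorem delta_formula {p : ℕ → K} (hp : Generic p [0, 1, 2, 3, 4, 5, 6]) :
    delta 4 (relations 3 K) (relations 1 K)
      (lsum formula fun t => symbAt 4 (coord p) t.toF) = 0 := by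
  have h := genericDefect_eval hp
  rw [genericDefect, FTensor.eval_append, FTensor.eval_append, FTensor.eval_smul] at h
  rw [formula, lsum_cons, lsum_append, lsum_scale, ← lsum_symbAt_comp 4 p shift_eq_six, map_add,
    map_add, map_zsmul, map_zsmul, delta_generic hp, delta_fSymbols hp.left,
    delta_fSymbols hp.shift, psiT_shift, smul_comm (-1 : ℤ) (20 : ℤ), ← smul_add, ← smul_add,
    ← add_assoc, h, smul_zero]

theorem dilogPt_comp (p : ℕ → K) {σ : ℕ → ℕ} (hσ : ∀ i, σ i = 6 ↔ i = 6) (i j k : ℕ) :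
    dilogPt (p ∘ σ) i j k = dilogPt p (σ i) (σ j) (σ k) := by
  simp [dilogPt, hσ]

variable [Infinite K]

/-- The component in `Λ² H_2` of the cobracket of `20 f`. -/
theorem deltaWedge_fSymbols {p : ℕ → K} (hp : Generic p [0, 1, 2, 3, 4, 6]) :
    deltaWedge 4 (relations 2 K) (lsum fSymbols fun t => symbAt 4 (coord p) t.toF) =
      (psiWedge 0 1 2 3 4).eval (wedgeMap (H 2 K)) (dilogAt p) (dilogAt p) := by
  have h := wedgeDefect_symmetric.eval_eq_zero (dilogAt p)
  rw [wedgeDefect, FTensor.eval_append, FTensor.eval_smul, FTensor.eval_bind, neg_one_smul,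
    ← sub_eq_add_neg, sub_eq_zero] at h
  rw [map_lsum, lsum_congr (w := fun t => (cobracketWedge t).eval (wedgeMap (H 2 K)) (dilogAt p)
    (dilogAt p)) fun t ht => deltaWedge_four_formal hp (fSymbols_ok t ht)]
  exact h

theorem psiWedge_shift (p : ℕ → K) :
    (psiWedge 0 1 2 3 4).eval (wedgeMap (H 2 K)) (dilogAt (p ∘ shift)) (dilogAt (p ∘ shift)) =
      (psiWedge 1 2 3 4 5).eval (wedgeMap (H 2 K)) (dilogAt p) (dilogAt p) := by
  simp only [psiWedge, cyclL, List.cons_append, List.nil_append, FTensor.eval_cons,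
    FTensor.eval_nil, lsum_scale, lsum_tripL, dilogPt_comp p shift_eq_six]
  rfl

theorem deltaWedge_formula {p : ℕ → K} (hp : Generic p [0, 1, 2, 3, 4, 5, 6]) :
    deltaWedge 4 (relations 2 K) (lsum formula fun t => symbAt 4 (coord p) t.toF) = 0 := by
  have h := generic_wedge_symmetric.eval_eq_zero (dilogAt p)
  rw [FTensor.eval_append, FTensor.eval_append, FTensor.eval_smul, FTensor.eval_smul] at h
  rw [formula, lsum_cons, lsum_append, lsum_scale, ← lsum_symbAt_comp 4 p shift_eq_six, map_add,
    map_add, map_zsmul, map_zsmul, deltaWedge_fSymbols hp.left, deltaWedge_fSymbols hp.shift,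
    deltaWedge_four_formal hp (formula_ok (20, _) (List.mem_cons_self ..)).1, psiWedge_shift,
    ← add_assoc, h]

end Formula

/-! ### The value of the formal version of `f` -/

section Value

variable {K : Type u} [Field K]

/-- The point of the projective line with index `i`. -/
def proj (p : ℕ → K) (i : ℕ) : OnePoint K := if i = 6 then OnePoint.infty else (p i : K)

omit [Field K] in
theorem proj_fin (p : ℕ → K) {i : ℕ} (hi : i ≠ 6) : proj p i = (p i : K) := if_neg hi

theorem crossRatio_proj (p : ℕ → K) {U V W X : ℕ} (hUV : U ≠ V) (hUW : U ≠ W) (hUX : U ≠ X)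
    (hVW : V ≠ W) (hVX : V ≠ X) (hWX : W ≠ X) :
    crossRatio (proj p U) (proj p V) (proj p W) (proj p X) = coord p (Chart.proj U V W, X) := by
  have hd : ∀ a b : K, diff (a : OnePoint K) (b : OnePoint K) = a - b := fun _ _ => rfl
  have hl : ∀ b : OnePoint K, diff OnePoint.infty b = 1 := fun _ => rfl
  have hr : ∀ a : OnePoint K, diff a OnePoint.infty = 1 := by
    intro a; cases a <;> rfl
  rw [crossRatio, coord]
  by_cases hU : U = 6
  · subst hU
    simp [proj, det_inf_left p hUW.symm, det_inf_left p hUX.symm, det_fin p hUV.symm hUX.symm,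
      det_fin p hUV.symm hUW.symm, hUV.symm, hUW.symm, hUX.symm, hd, hl]
  by_cases hV : V = 6
  · subst hV
    simp [proj, det_inf_left p hVW.symm, det_inf_left p hVX.symm, det_fin p hU hVX.symm,
      det_fin p hU hVW.symm, hU, hVW.symm, hVX.symm, hd, hl]
  by_cases hW : W = 6
  · subst hW
    simp [proj, det_inf_right p hU, det_inf_right p hV, det_fin p hU hWX.symm,
      det_fin p hV hWX.symm, hU, hV, hWX.symm, hd, hr]
    rw [← neg_sub (p V) (p X), ← neg_sub (p U) (p X), neg_div_neg_eq]
  by_cases hX : X = 6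
  · subst hX
    simp [proj, det_inf_right p hU, det_inf_right p hV, det_fin p hU hW,
      det_fin p hV hW, hU, hV, hW, hd, hr]
    rw [← neg_sub (p U) (p W), ← neg_sub (p V) (p W), neg_div_neg_eq]
  simp [proj, det_fin p, hU, hV, hW, hX, hd]

/-- The value of a building block: `[UVWX, UVWY]_{3,1}`, or `2 [(Z - X) / (Z - O)]_4`. -/
noncomputable def blockVal (p : ℕ → K) : Block → H 4 K
  | .li31 U V W X Y => hyp31 (crossRatio (proj p U) (proj p V) (proj p W) (proj p X))
      (crossRatio (proj p U) (proj p V) (proj p W) (proj p Y))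
  | .li4 Z O X => (2 : ℤ) • polylog4 ((p Z - p X) / (p Z - p O))

theorem lsum_symbols {p : ℕ → K} {S : List ℕ} (hp : Generic p S) {b : Block} (hb : b.Ok S) :
    lsum b.symbols (hypC 4 p) = blockVal p b := by
  have hV : ∀ U V W, coord p (Chart.proj U V W, V) = 0 := by
    intro U V W; simp [coord, det_self]
  have hW : ∀ {U V W}, U ∈ S → V ∈ S → W ∈ S → U ≠ W → V ≠ W →
      coord p (Chart.proj U V W, W) = 1 := by
    intro U V W hU hV hW h1 h2
    exact div_self (mul_ne_zero (hp U hU W hW h1) (hp V hV W hW h2))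
  cases b with
  | li31 U V W X Y =>
    obtain ⟨hn, hS⟩ := hb
    simp only [List.nodup_cons, List.mem_cons, List.not_mem_nil, or_false, not_or,
      not_false_eq_true, List.nodup_nil, and_true] at hn
    obtain ⟨⟨hUV, hUW, hUX, hUY⟩, ⟨hVW, hVX, hVY⟩, ⟨hWX, hWY⟩, hXY⟩ := hn
    have hU := hS U (by simp)
    have hV' := hS V (by simp)
    have hW' := hS W (by simp)
    rw [Block.symbols, lsum_cons, lsum_nil, one_smul, add_zero, blockVal,
      crossRatio_proj p hUV hUW hUX hVW hVX hWX, crossRatio_proj p hUV hUW hUY hVW hVY hWY, hyp31,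
      ← hV U V W, ← hW hU hV' hW' hUW hVW]
    rfl
  | li4 Z O X =>
    obtain ⟨hn, hS⟩ := hb
    simp only [List.nodup_cons, List.mem_cons, List.not_mem_nil, or_false, not_or,
      not_false_eq_true, List.nodup_nil, and_true] at hn
    obtain ⟨⟨h6Z, h6O, h6X⟩, ⟨hZO, hZX⟩, hOX⟩ := hn
    have h6 := hS 6 (by simp)
    have hZ := hS Z (by simp)
    have hO := hS O (by simp)
    have hX : coord p (Chart.proj 6 Z O, X) = (p Z - p X) / (p Z - p O) := by
      simp [coord, det_inf_left p (Ne.symm h6X), det_inf_left p (Ne.symm h6O),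
        det_fin p (Ne.symm h6Z) (Ne.symm h6X), det_fin p (Ne.symm h6Z) (Ne.symm h6O)]
    rw [Block.symbols, lsum_cons, lsum_nil, add_zero, blockVal, polylog4, ← hX, smul_neg,
      ← neg_smul, ← hV 6 Z O, ← hW h6 hZ hO h6O hZO]
    rfl

theorem lsum_gL (p : ℕ → K) (A B C D E : ℕ) :
    lsum (gL A B C D E) (blockVal p) = g (proj p A) (proj p B) (proj p C) (proj p D) (proj p E) := by
  simp only [gL, cyclL, List.cons_append, List.nil_append, lsum_cons, lsum_nil, blockVal, g, cycl]
  module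

theorem lsum_fL (p : ℕ → K) :
    lsum (fL 0 1 2 3 4) (blockVal p) = (20 : ℚ) • f (p 0) (p 1) (p 2) (p 3) (p 4) := by
  have h6 : proj p 6 = OnePoint.infty := if_pos rfl
  have h : ∀ i < 6, proj p i = (p i : K) := fun i hi => proj_fin p (by omega)
  simp only [fL, lsum_append, lsum_scale, lsum_gL, h6, h 0 (by omega), h 1 (by omega),
    h 2 (by omega), h 3 (by omega), h 4 (by omega), f, cyclL, cycl, List.cons_append,
    List.nil_append, lsum_cons, lsum_nil, blockVal]
  module

theorem lsum_fSymbols {p : ℕ → K} (hp : Generic p [0, 1, 2, 3, 4, 6]) :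
    lsum fSymbols (hypC 4 p) = (20 : ℚ) • f (p 0) (p 1) (p 2) (p 3) (p 4) := by
  rw [fSymbols, lsum_lbind, lsum_congr fun t ht => lsum_symbols hp (fL_ok t ht), lsum_fL]

theorem lsum_formula {p : ℕ → K} (hp : Generic p [0, 1, 2, 3, 4, 6])
    (hp' : Generic (p ∘ shift) [0, 1, 2, 3, 4, 6]) :
    lsum formula (hypC 4 p) = (20 : ℚ) • (hyp 4 (p 0) [p 1, p 2, p 3, p 4] (p 5) -
      f (p 0) (p 1) (p 2) (p 3) (p 4) + f (p 1) (p 2) (p 3) (p 4) (p 5)) := by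
  have h1 : hypC 4 p (Chart.affine, 0, [1, 2, 3, 4], 5) =
    hyp 4 (p 0) [p 1, p 2, p 3, p 4] (p 5) := rfl
  have h2 : lsum fSymbols (hypC 4 (p ∘ shift)) =
    (20 : ℚ) • f (p 1) (p 2) (p 3) (p 4) (p 5) := lsum_fSymbols hp'
  rw [formula, lsum_cons, lsum_append, lsum_scale, ← lsum_hypC_comp 4 p shift_eq_six, h1, h2,
    lsum_fSymbols hp]
  module

theorem cycl_rotate {X M : Type*} [AddCommMonoid M] (h : X → X → X → X → X → M) (A B C D E : X) :
    cycl h A B C D E = cycl h B C D E A := by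
  simp only [cycl]
  abel

/-- The function `f` is invariant under cyclic permutations. -/
theorem f_rotate (A B C D E : K) : f A B C D E = f B C D E A := by
  have hg : ∀ A B C D E : OnePoint K, g A B C D E = g B C D E A := fun A B C D E => by
    unfold g
    exact cycl_rotate _ A B C D E
  have hc : ∀ h : K → K → K → K → K → H 4 K, cycl h A B C D E = cycl h B C D E A := fun h =>
    cycl_rotate h A B C D E
  simp only [f]
  rw [hg A B C D E, hg OnePoint.infty B C D E, hg A OnePoint.infty C D E,
    hg A B OnePoint.infty D E, hg A B C OnePoint.infty E, hg A B C D OnePoint.infty, hc, hc, hc, hc]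
  have key : ∀ a b c d e i x y z w : H 4 K,
      a - b - c - d - e - i + x - y + z - w = a - c - d - e - i - b + x - y + z - w := by
    intros
    abel
  exact congrArg _ (key _ _ _ _ _ _ _ _ _ _)

theorem generic_of_nodup {A B C D E F : K} (h : [A, B, C, D, E, F].Nodup) :
    Generic (fun i => [A, B, C, D, E, F].getD i 0) [0, 1, 2, 3, 4, 5, 6] := by
  have hlt : ∀ i ∈ [0, 1, 2, 3, 4, 5, 6], i ≠ 6 → i < 6 := by decide
  intro i hi j hj hij
  by_cases hi6 : i = 6
  · subst hi6
    rw [det_inf_left _ (Ne.symm hij)]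
    exact one_ne_zero
  by_cases hj6 : j = 6
  · subst hj6
    rw [det_inf_right _ hi6]
    exact neg_ne_zero.2 one_ne_zero
  have hi' : i < [A, B, C, D, E, F].length := hlt i hi hi6
  have hj' : j < [A, B, C, D, E, F].length := hlt j hj hj6
  rw [det_fin _ hi6 hj6, sub_ne_zero]
  simp only [List.getD_eq_getElem _ _ hi', List.getD_eq_getElem _ _ hj']
  exact fun h' => hij ((h.getElem_inj_iff).1 h')

end Value

end Hyperlog

theorem mainTheorem1 {K : Type u} [Field K] (A B C D E F : K)
    (h₁ : [A, B, C, D, E].Nodup) (h₂ : [B, C, D, E, F].Nodup) :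
    Hyperlog.hyp 4 A [B, C, D, E] F = Hyperlog.f A B C D E - Hyperlog.f B C D E F := by
  open Hyperlog in
  by_cases hAF : A = F
  -- the path is constant, and the two values of `f` agree
  · subst hAF
    rw [hyp_constant_path 2, f_rotate A, sub_self]
  have hn : [A, B, C, D, E, F].Nodup := by
    rw [List.nodup_cons] at h₁ ⊢
    refine ⟨?_, h₂⟩
    have := h₁.1
    simp only [List.mem_cons, List.not_mem_nil, or_false, not_or] at this ⊢
    tauto
  have hp := generic_of_nodup hn
  set p : ℕ → K := fun i => [A, B, C, D, E, F].getD i 0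
  -- the path that moves `F` to `A` along a line and leaves the other points fixed
  have h0 : ∀ i, Spec 0 (segment (p i) (p (closeUp i))) (p i) := fun i => spec_segment_zero _ _
  have hX := hp.of_spec h0
  have key := lsum_hypC_relabel (n := 2) hp closeUp_eq_six (fun t ht => (formula_ok t ht).1)
    (fun t ht => (formula_ok t ht).2) _ h0 (fun i => spec_segment_one _ _)
    (fun k hk => by
      obtain rfl : k = 1 := by omega
      exact delta_formula hX)
    (fun k hk => by
      obtain rfl : k = 2 := by omega
      exact deltaWedge_formula hX)
  have hq : Generic (p ∘ closeUp) [0, 1, 2, 3, 4, 6] :=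
    hp.comp closeUp_eq_six (by decide) (by decide)
  have hq' : Generic ((p ∘ closeUp) ∘ shift) [0, 1, 2, 3, 4, 6] :=
    hp.comp (σ := closeUp ∘ shift) (fun i => (closeUp_eq_six _).trans (shift_eq_six i))
      (by decide) (by decide)
  -- at the end of the path the symbol vanishes and the two values of `f` agree
  rw [← lsum_hypC_comp 4 p closeUp_eq_six, lsum_formula hp.left hp.shift, lsum_formula hq hq'] at key
  have key' : (20 : ℚ) • (hyp 4 A [B, C, D, E] F - f A B C D E + f B C D E F) =
    (20 : ℚ) • (hyp 4 A [B, C, D, E] A - f A B C D E + f B C D E A) := key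
  rw [hyp_constant_path 2, ← f_rotate A, zero_sub, neg_add_cancel, smul_zero] at key'
  have h := (smul_eq_zero.1 key').resolve_left (by norm_num)
  rw [sub_add, sub_eq_zero] at h
  exact h
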